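/- **Theorem.** Let $N_{\mathbb R}$ be a finite-dimensional real vector space with dual $M_{\mathbb R}$ and let $*$ be an inner product on $N_{\mathbb R}$. Let $\Sigma$ be a finite simplicial polyhedral fan in $N_{\mathbb R}$ all of whose maximal cones have dimension $d\ge 0$, with a chosen generator $u_\rho$ of each ray $\rho\in\Sigma(1)$; write $\Sigma(k)$ for the set of $k$-dimensional cones, $\sigma(1)$ for the set of rays of a cone $\sigma$, and $N_{\sigma,\mathbb R}$ for the linear span of $\sigma$. Let $\omega:\Sigma(d)\to\mathbb R_{>0}$ be such that $(\Sigma,\omega)$ is tropical, i.e. for every $\tau\in\Sigma(d-1)$ $$\sum_{\sigma\in\Sigma(d),\ \tau\preceq\sigma}\omega(\sigma)\,u_{\sigma\setminus\tau}\in N_{\tau,\mathbb R},$$ where $\sigma\setminus\tau$ denotes the unique ray of $\sigma$ not in $\tau$. Let $$A^\bullet(\Sigma)=\mathbb R[x_\rho\mid\rho\in\Sigma(1)]\big/(\mathcal I+\mathcal J),\qquad \mathcal I=\langle x_{\rho_1}\cdots x_{\rho_k}\mid \mathrm{cone}(\rho_1,\dots,\rho_k)\notin\Sigma\rangle,\qquad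 \mathcal J=\Big\langle \sum_{\rho}\langle v,u_\rho\rangle x_\rho\ \Big|\ v\in M_{\mathbb R}\Big\rangle$$ be the Chow ring, graded by degree, with $X_\rho=[x_\rho]$ and $X_\sigma=\prod_{\rho\in\sigma(1)}X_\rho$. Then there is a unique linear map $\deg_{\Sigma,\omega}:A^d(\Sigma)\to\mathbb R$ with $\deg_{\Sigma,\omega}(X_\sigma)=\omega(\sigma)$ for all $\sigma\in\Sigma(d)$, and for every $D\in A^1(\Sigma)$ and every $z\in\mathbb R^{\Sigma(1)}$ with $D=\sum_\rho z_\rho X_\rho$, $$\deg_{\Sigma,\omega}(D^d)=\sum_{\sigma\in\Sigma(d)}\omega(\sigma)\det(G_\sigma)\sum_{f\in L(\sigma)}\prod_{j=1}^d\frac{\det\big(G_{\sigma(f,j),f(j)}(z)\big)}{\det\big(G_{\sigma(f,j)}\big)}.$$ Here $L(\sigma)$ is the set of bijections $f:\{1,\dots,d\}\to\sigma(1)$; $\sigma(f,j)$ is the face of $\sigma$ with rays $f(1),\dots,f(j)$; $G_\tau=(u_\rho*u_\eta)_{\rho,\eta\in\tau(1)}$; and $G_{\tau,\rho}(z)$ is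 obtained from $G_\tau$ by replacing the column of $\rho$ with $(z_\eta)_{\eta\in\tau(1)}$. In particular, if $z$ is pseudo-cubical, i.e. for every $\sigma\in\Sigma$ the set $\sigma\cap\{v\in N_{\mathbb R}\mid v*u_\rho=z_\rho\text{ for all }\rho\in\sigma(1)\}$ is nonempty, then $$\deg_{\Sigma,\omega}(D^d)=\mathrm{Vol}(C_{\Sigma,*}(z);\omega)=\sum_{\sigma\in\Sigma(d)}\omega(\sigma)\,\mathrm{Vol}_\sigma(P_{\sigma,*}(z)),$$ the $\omega$-weighted volume of the normal complex $C_{\Sigma,*}(z)$, the polytopal complex formed by the polytopes $P_{\sigma,*}(z)=\sigma\cap\{v\in N_{\mathbb R}\mid v*u_\rho\le z_\rho\text{ for all }\rho\in\sigma(1)\}$, $\sigma\in\Sigma$, and their faces; its weighted volume is by definition the sum on the right. Here $\mathrm{Vol}_\sigma$ is the volume on $N_{\sigma,\mathbb R}$ normalized so that a fundamental simplex of the lattice $M_\sigma$ has volume one, where $M_\sigma=\{v\in N_{\sigma,\mathbb R}\mid v*w\in\mathbb Z\text{ for all }w\in N_\sigma\}$ is the dual of the lattice $N_\sigma=\mathrm{span}_{\mathbb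 Z}(u_\rho\mid\rho\in\sigma(1))$. -/

import Mathlib

open scoped InnerProductSpace

noncomputable section

/-- A marked simplicial polyhedral fan in the real vector space `V` whose rays are indexed by the
finite type `ι`.  The ray `i` is spanned by its distinguished generator `u i`, and a cone of the fan
is recorded by the finite set of its rays: `σ ∈ cones` stands for the cone generated by the `u i`
with `i ∈ σ`.  As the generators of each cone are linearly independent, the faces of that cone are
the cones on the subsets of `σ`, and its dimension is the cardinality of `σ`. -/
structure SimplicialFan (V ι : Type*) [AddCommGroup V] [Module ℝ V] [DecidableEq ι] where
  /-- the distinguished ray generators -/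
  u : ι → V
  /-- the cones, each given by its set of rays -/
  cones : Finset (Finset ι)
  /-- the fan contains the zero cone -/
  empty_mem : ∅ ∈ cones
  /-- every index is a ray of the fan -/
  singleton_mem : ∀ i, {i} ∈ cones
  /-- every cone is simplicial -/
  linearIndepOn : ∀ σ ∈ cones, LinearIndepOn ℝ u (σ : Set ι)
  /-- a face of a cone of the fan is in the fan -/
  face_mem : ∀ σ ∈ cones, ∀ τ ⊆ σ, τ ∈ cones
  /-- two cones of the fan intersect in their common face -/
  inter_eq : ∀ σ ∈ cones, ∀ τ ∈ cones,
    PointedCone.hull ℝ (u '' (σ : Set ι)) ⊓ PointedCone.hull ℝ (u '' (τ : Set ι)) =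
      PointedCone.hull ℝ (u '' ((σ ∩ τ : Finset ι) : Set ι))

namespace SimplicialFan

section Linear

variable {V ι : Type*} [AddCommGroup V] [Module ℝ V] [DecidableEq ι]

/-- The cone in `V` generated by the rays in `σ`. -/
def cone (F : SimplicialFan V ι) (σ : Finset ι) : PointedCone ℝ V :=
  PointedCone.hull ℝ (F.u '' (σ : Set ι))

/-- The linear span `N_{σ,ℝ}` of the cone on `σ`. -/
def spanR (F : SimplicialFan V ι) (σ : Finset ι) : Submodule ℝ V :=
  Submodule.span ℝ (F.u '' (σ : Set ι))

/-- The lattice `N_σ` generated by the ray generators of `σ`. -/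
def latticeN (F : SimplicialFan V ι) (σ : Finset ι) : Submodule ℤ V :=
  Submodule.span ℤ (F.u '' (σ : Set ι))

/-- The set `Σ(k)` of `k`-dimensional cones. -/
def conesOfDim (F : SimplicialFan V ι) (k : ℕ) : Finset (Finset ι) :=
  {σ ∈ F.cones | σ.card = k}

/-- The fan is a `d`-fan: all its maximal cones have dimension `d`. -/
def IsPure (F : SimplicialFan V ι) (d : ℕ) : Prop :=
  ∀ σ, Maximal (fun τ => τ ∈ F.cones) σ → σ.card = d

/-- `(Σ, ω)` is a tropical `d`-fan: `Σ` is a `d`-fan, `ω` is positive on `Σ(d)`, and the weighted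
balancing condition holds at each `τ ∈ Σ(d-1)`.  (Only the values of `ω` on `Σ(d)` matter.  For
`τ ⊆ σ` with `σ ∈ Σ(d)`, the set `σ \ τ` has exactly one element, so that the inner sum is
`u_{σ \ τ}`.) -/
structure IsTropical (F : SimplicialFan V ι) (d : ℕ) (ω : Finset ι → ℝ) : Prop where
  pure : F.IsPure d
  weight_pos : ∀ σ ∈ F.conesOfDim d, 0 < ω σ
  balanced : ∀ τ ∈ F.cones, τ.card + 1 = d →
    ∑ σ ∈ F.conesOfDim d with τ ⊆ σ, ω σ • ∑ i ∈ σ \ τ, F.u i ∈ F.spanR τ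

/-- The ideal generated by the squarefree monomials whose rays do not span a cone of the fan. -/
def idealI (F : SimplicialFan V ι) : Ideal (MvPolynomial ι ℝ) :=
  Ideal.span {p | ∃ s : Finset ι, s ∉ F.cones ∧ p = ∏ i ∈ s, MvPolynomial.X i}

/-- The ideal generated by the linear forms `∑ ⟨v, u_ρ⟩ x_ρ` with `v` in the dual space. -/
def idealJ [Fintype ι] (F : SimplicialFan V ι) : Ideal (MvPolynomial ι ℝ) :=
  Ideal.span {p | ∃ v : Module.Dual ℝ V,
    p = ∑ i, MvPolynomial.C (v (F.u i)) * MvPolynomial.X i}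

/-- The Chow ring `A^•(Σ)`. -/
abbrev ChowRing [Fintype ι] (F : SimplicialFan V ι) : Type _ :=
  MvPolynomial ι ℝ ⧸ (F.idealI ⊔ F.idealJ)

variable [Fintype ι]

/-- The generator `X_ρ` of the Chow ring. -/
def divX (F : SimplicialFan V ι) (i : ι) : F.ChowRing :=
  Ideal.Quotient.mk (F.idealI ⊔ F.idealJ) (MvPolynomial.X i)

/-- The homogeneous part `A^k(Σ)`: the classes of homogeneous polynomials of degree `k`. -/
def chowGr (F : SimplicialFan V ι) (k : ℕ) : Submodule ℝ F.ChowRing :=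
  (MvPolynomial.homogeneousSubmodule ι ℝ k).map
    (Ideal.Quotient.mkₐ ℝ (F.idealI ⊔ F.idealJ)).toLinearMap

theorem pow_mem_chowGr (F : SimplicialFan V ι) {D : F.ChowRing} (hD : D ∈ F.chowGr 1) (k : ℕ) :
    D ^ k ∈ F.chowGr k := by
  obtain ⟨p, hp, rfl⟩ := hD
  refine ⟨p ^ k, ?_, by simp⟩
  have h : p.IsHomogeneous 1 := hp
  simpa using h.pow k

theorem prod_divX_mem_chowGr (F : SimplicialFan V ι) {k : ℕ} {σ : Finset ι}
    (hσ : σ ∈ F.conesOfDim k) : ∏ i ∈ σ, F.divX i ∈ F.chowGr k := by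
  have hk : σ.card = k := (Finset.mem_filter.1 hσ).2
  refine ⟨∏ i ∈ σ, MvPolynomial.X i, ?_, by simp [divX]⟩
  have h := MvPolynomial.IsHomogeneous.prod σ (fun i => (MvPolynomial.X i : MvPolynomial ι ℝ))
    (fun _ => 1) (fun i _ => MvPolynomial.isHomogeneous_X ℝ i)
  simpa [hk] using h

/-- A linear map `A^d(Σ) → ℝ` is a degree map of `(Σ, ω)` if it sends `X_σ = ∏_{ρ ∈ σ(1)} X_ρ` to
`ω σ` for each `σ ∈ Σ(d)`. -/
def IsDegreeMap (F : SimplicialFan V ι) (d : ℕ) (ω : Finset ι → ℝ)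
    (deg : F.chowGr d →ₗ[ℝ] ℝ) : Prop :=
  ∀ σ (hσ : σ ∈ F.conesOfDim d), deg ⟨∏ i ∈ σ, F.divX i, F.prod_divX_mem_chowGr hσ⟩ = ω σ

/-- The volume polynomial `D ↦ deg (D ^ d)` on `A^1(Σ)` belonging to a degree map. -/
def volumePolynomial (F : SimplicialFan V ι) (d : ℕ) (deg : F.chowGr d →ₗ[ℝ] ℝ)
    (D : F.chowGr 1) : ℝ :=
  deg ⟨(D : F.ChowRing) ^ d, F.pow_mem_chowGr D.2 d⟩

end Linear

section Inner

variable {V ι : Type*} [NormedAddCommGroup V] [InnerProductSpace ℝ V] [DecidableEq ι]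

/-- The Gram matrix `G_σ`. -/
def gram (F : SimplicialFan V ι) (σ : Finset ι) : Matrix σ σ ℝ :=
  Matrix.of fun η θ => ⟪F.u η, F.u θ⟫_ℝ

/-- The matrix `G_{σ,ρ}(z)`: the Gram matrix `G_σ` with the column of `ρ` replaced by
`(z_η)_{η ∈ σ(1)}`. -/
def gramReplace (F : SimplicialFan V ι) (σ : Finset ι) (ρ : ι) (z : ι → ℝ) : Matrix σ σ ℝ :=
  Matrix.of fun η θ => if (θ : ι) = ρ then z η else F.gram σ η θ

/-- For an ordering `f` of the rays of `σ`, the face `σ(f,j)` with rays `f(i)`, `i ≤ j`. -/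
def orderedFace {d : ℕ} {σ : Finset ι} (f : Fin d ≃ σ) (j : Fin d) : Finset ι :=
  (Finset.Iic j).image fun i => (f i : ι)

/-- The expression
`det(G_σ) ∑_{f ∈ L(σ)} ∏_{j=1}^{d} det(G_{σ(f,j),f(j)}(z)) / det(G_{σ(f,j)})`,
where `L(σ)` is the set of bijections from `{1, …, d}` to the set of rays of `σ`. -/
def gramSum (F : SimplicialFan V ι) (d : ℕ) (σ : Finset ι) (z : ι → ℝ) : ℝ :=
  (F.gram σ).det * ∑ f : Fin d ≃ σ, ∏ j : Fin d,
    (F.gramReplace (orderedFace f j) (f j) z).det / (F.gram (orderedFace f j)).det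

/-- `z` is pseudo-cubical: for each cone `σ` of the fan, the hyperplanes `v * u_ρ = z_ρ` with
`ρ ∈ σ(1)` meet in a point of `σ`. -/
def IsPseudoCubical (F : SimplicialFan V ι) (z : ι → ℝ) : Prop :=
  ∀ σ ∈ F.cones, ((F.cone σ : Set V) ∩ {v : V | ∀ i ∈ σ, ⟪v, F.u i⟫_ℝ = z i}).Nonempty

/-- The polytope `P_{σ,*}(z)`, the cone `σ` truncated by the half-spaces `v * u_ρ ≤ z_ρ` with
`ρ ∈ σ(1)`. -/
def polytope (F : SimplicialFan V ι) (σ : Finset ι) (z : ι → ℝ) : Set V :=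
  (F.cone σ : Set V) ∩ {v : V | ∀ i ∈ σ, ⟪v, F.u i⟫_ℝ ≤ z i}

/-- The dual lattice `M_σ` of `N_σ`, viewed in `N_{σ,ℝ}` through the inner product. -/
def latticeM (F : SimplicialFan V ι) (σ : Finset ι) : Submodule ℤ (F.spanR σ) where
  carrier := {v | ∀ w ∈ F.latticeN σ, ∃ n : ℤ, ⟪(v : V), w⟫_ℝ = n}
  zero_mem' := fun w _ => ⟨0, by simp⟩
  add_mem' := by
    intro a b ha hb w hw
    obtain ⟨m, hm⟩ := ha w hw
    obtain ⟨n, hn⟩ := hb w hw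
    exact ⟨m + n, by simp [inner_add_left, hm, hn]⟩
  smul_mem' := by
    intro c a ha w hw
    obtain ⟨m, hm⟩ := ha w hw
    refine ⟨c * m, ?_⟩
    rw [← Int.cast_smul_eq_zsmul ℝ c a]
    simp [real_inner_smul_left, hm]

variable [FiniteDimensional ℝ V] [MeasurableSpace V] [BorelSpace V]

/-- The volume `Vol_σ` on `N_{σ,ℝ}`, normalized so that a fundamental simplex of `M_σ` has volume
one.  A fundamental simplex of a lattice of rank `k` has `1 / k!` times the covolume of the lattice,
and the quotient does not depend on the chosen Haar measure. -/
def coneVolume (F : SimplicialFan V ι) (σ : Finset ι) (P : Set V) : ℝ :=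
  (σ.card.factorial : ℝ) *
    (MeasureTheory.Measure.addHaar : MeasureTheory.Measure (F.spanR σ)).real
      ((fun v : F.spanR σ => (v : V)) ⁻¹' P) /
    ZLattice.covolume (F.latticeM σ)
      (MeasureTheory.Measure.addHaar : MeasureTheory.Measure (F.spanR σ))

/-- The volume `Vol(C_{Σ,*}(z); ω)` of the normal complex, weighted by `ω`: the weighted sum of the
volumes of its `d`-dimensional polytopes `P_{σ,*}(z)`, `σ ∈ Σ(d)`. -/
def normalComplexVolume (F : SimplicialFan V ι) (d : ℕ) (ω : Finset ι → ℝ) (z : ι → ℝ) : ℝ :=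
  ∑ σ ∈ F.conesOfDim d, ω σ * F.coneVolume σ (F.polytope σ z)

end Inner

end SimplicialFan

end

/-!
The degree map is constructed from tropical intersection theory.  A balanced weight is a function on
the cones of the fan satisfying the balancing condition of `IsTropical` at every cone.  A piecewise
linear function, given by its values `z` at the ray generators, has a divisor on every balanced
weight, which is again balanced (`divisor_mem_balancedWeights`); the operators so obtained commute
(`divisor_comm`), and they vanish for globally linear functions (`divisor_linear`).  Both facts are
local around a cone `κ`: after subtracting a linear function, `z` vanishes on `κ`, and then the
divisor near `κ` is given by a symmetric matrix of weights and self-intersection numbers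
(`exists_selfIntersection`).  Hence the polynomial ring acts on balanced weights.  The ideal `J`
acts by zero, and a squarefree monomial shifts weights along its set of rays
(`polynomialAction_prod_X`), so that evaluating the action on `ω` at the zero cone kills `I` and
sends `X_σ` to `ω(σ)`.  Uniqueness holds because the classes `X_σ` span `A^d` (`chowGr_le_span`).

The formula for the divisor contains the numbers `z_η - w_τ * u_η`, where the vertex `w_τ` is the
vector in the span of `τ` with `w_τ * u_ρ = z_ρ` on `τ`.  By Cramer's rule such a number is the
coefficient of `u_η` in the vertex of `τ ∪ η`, times `det G_{τ ∪ η} / det G_τ`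
(`sub_inner_vertex`).  Iterating the divisor `d` times starting from `ω` therefore produces the sum
over ordered cones (`divisorHom_pow_apply_empty`).

If `z` is pseudo-cubical, the polytope of a cone `σ` is the union of the pyramids with apex the
vertex of `σ` over the polytopes of the facets of `σ`; these polytopes are indeed faces of the
polytope of `σ` (`inner_le_of_mem_polytope`).  In coordinates with respect to the ray generators,
the height of the pyramid is the coefficient of the vertex at the omitted ray, which gives for the
volumes the same recursion as for the sum over orderings (`volume_coordPolytope_eq_sum`,
`orderingSum_succ`).  The factor `det G_σ` is the determinant of the generators of `σ` with respect
to the dual basis, which spans the lattice `M_σ` (`coneVolume_polytope`).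
-/

noncomputable section

namespace SimplicialFan

/-! ### The vertices of the normal complex and Cramer's rule -/

section Gram

variable {V ι : Type*} [NormedAddCommGroup V] [InnerProductSpace ℝ V] [DecidableEq ι]

theorem det_gram_pos (F : SimplicialFan V ι) {σ : Finset ι} (hσ : σ ∈ F.cones) :
    0 < (F.gram σ).det :=
  (Matrix.posDef_gram_of_linearIndependent (F.linearIndepOn σ hσ)).det_pos

/-- The quotient `det G_{σ,ρ}(z) / det G_σ`.  By Cramer's rule it is, for `ρ ∈ σ`, the coefficient
of `u_ρ` in the vector `v` of the span of `σ` with `v * u_η = z_η` for all `η ∈ σ`. -/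
def coord (F : SimplicialFan V ι) (σ : Finset ι) (z : ι → ℝ) (ρ : ι) : ℝ :=
  (F.gramReplace σ ρ z).det / (F.gram σ).det

/-- The vector `v` of the span of `σ` with `v * u_ρ = z_ρ` for all `ρ ∈ σ`. -/
def vertex (F : SimplicialFan V ι) (σ : Finset ι) (z : ι → ℝ) : V :=
  ∑ i ∈ σ, F.coord σ z i • F.u i

theorem gramReplace_eq_updateCol (F : SimplicialFan V ι) (σ : Finset ι) (ρ : σ) (z : ι → ℝ) :
    F.gramReplace σ ρ z = (F.gram σ).updateCol ρ (fun i => z i) := by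
  ext i j
  simp only [gramReplace, Matrix.of_apply, Matrix.updateCol_apply, Subtype.ext_iff]

theorem det_gramReplace (F : SimplicialFan V ι) (σ : Finset ι) (ρ : σ) (z : ι → ℝ) :
    (F.gramReplace σ ρ z).det = (F.gram σ).cramer (fun i => z i) ρ := by
  rw [gramReplace_eq_updateCol, Matrix.cramer_apply]

theorem inner_vertex (F : SimplicialFan V ι) {σ : Finset ι} (hσ : σ ∈ F.cones) (z : ι → ℝ)
    {i : ι} (hi : i ∈ σ) : ⟪F.vertex σ z, F.u i⟫_ℝ = z i := by
  have h := congrFun (Matrix.mulVec_cramer (F.gram σ) (fun i => z i)) ⟨i, hi⟩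
  have hd := (F.det_gram_pos hσ).ne'
  simp only [Matrix.mulVec, dotProduct, Pi.smul_apply, smul_eq_mul, ← det_gramReplace] at h
  rw [vertex, real_inner_comm, inner_sum, ← Finset.sum_coe_sort]
  simp only [inner_smul_right, coord]
  rw [← mul_right_inj' hd, ← h, Finset.mul_sum]
  refine Finset.sum_congr rfl fun j _ => ?_
  rw [show F.gram σ ⟨i, hi⟩ j = ⟪F.u i, F.u j⟫_ℝ from rfl]
  field_simp

theorem u_mem_spanR (F : SimplicialFan V ι) {σ : Finset ι} {i : ι} (hi : i ∈ σ) :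
    F.u i ∈ F.spanR σ :=
  Submodule.subset_span ⟨i, hi, rfl⟩

theorem vertex_mem_spanR (F : SimplicialFan V ι) (σ : Finset ι) (z : ι → ℝ) :
    F.vertex σ z ∈ F.spanR σ :=
  Submodule.sum_mem _ fun _ hi => Submodule.smul_mem _ _ (F.u_mem_spanR hi)

theorem inner_eq_zero_of_mem_spanR (F : SimplicialFan V ι) {σ : Finset ι} {y : V}
    (hy : ∀ i ∈ σ, ⟪y, F.u i⟫_ℝ = 0) {x : V} (hx : x ∈ F.spanR σ) : ⟪y, x⟫_ℝ = 0 := by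
  refine Submodule.span_induction ?_ (by simp) (fun a b _ _ ha hb => ?_) (fun c a _ ha => ?_) hx
  · rintro _ ⟨i, hi, rfl⟩
    exact hy i hi
  · rw [inner_add_right, ha, hb, add_zero]
  · rw [inner_smul_right, ha, mul_zero]

theorem eq_of_mem_spanR_of_inner_eq (F : SimplicialFan V ι) {σ : Finset ι} {x y : V}
    (hx : x ∈ F.spanR σ) (hy : y ∈ F.spanR σ) (h : ∀ i ∈ σ, ⟪x, F.u i⟫_ℝ = ⟪y, F.u i⟫_ℝ) :
    x = y := by
  rw [← sub_eq_zero, ← inner_self_eq_zero (𝕜 := ℝ)]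
  refine F.inner_eq_zero_of_mem_spanR (fun i hi => ?_) (Submodule.sub_mem _ hx hy)
  rw [inner_sub_left, h i hi, sub_self]

theorem eq_of_sum_smul_eq (F : SimplicialFan V ι) {σ : Finset ι} (hσ : σ ∈ F.cones) {a b : ι → ℝ}
    (h : ∑ i ∈ σ, a i • F.u i = ∑ i ∈ σ, b i • F.u i) {i : ι} (hi : i ∈ σ) : a i = b i := by
  have hl := linearIndepOn_finset_iff.1 (F.linearIndepOn σ hσ) (fun i => a i - b i)
    (by simp only [sub_smul, Finset.sum_sub_distrib, h, sub_self]) i hi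
  linarith

/-- If `σ` arises from `τ` by adding the ray `η`, then the coefficient of `u_η` in the vertex of
`σ` measures by how much the vertex of `τ` falls short of the hyperplane `v * u_η = z_η`. -/
theorem sub_inner_vertex (F : SimplicialFan V ι) {τ : Finset ι} {η : ι} (hη : η ∉ τ)
    (hσ : insert η τ ∈ F.cones) (z : ι → ℝ) :
    (z η - ⟪F.vertex τ z, F.u η⟫_ℝ) * (F.gram τ).det =
      F.coord (insert η τ) z η * (F.gram (insert η τ)).det := by
  have hτ : τ ∈ F.cones := F.face_mem _ hσ τ (Finset.subset_insert η τ)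
  have hd := (F.det_gram_pos hσ).ne'
  set σ := insert η τ with hσdef
  have hησ : η ∈ σ := Finset.mem_insert_self η τ
  set e : σ := ⟨η, hησ⟩ with he
  set G := F.gram σ with hG
  set φ := z η - ⟪F.vertex τ z, F.u η⟫_ℝ with hφ
  set x : σ → ℝ := fun i => if (i : ι) = η then 0 else F.coord τ z i with hx
  have hGx : ∀ i : σ, (G.mulVec x) i = ⟪F.vertex τ z, F.u i⟫_ℝ := by
    intro i
    simp only [Matrix.mulVec, dotProduct, hG, gram, Matrix.of_apply, hx]
    refine (Finset.sum_coe_sort σ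
      (fun j => ⟪F.u i, F.u j⟫_ℝ * if j = η then (0 : ℝ) else F.coord τ z j)).trans ?_
    refine (Finset.sum_insert hη).trans ?_
    rw [vertex, real_inner_comm (F.u i), inner_sum]
    simp only [if_true, mul_zero, zero_add]
    refine Finset.sum_congr rfl fun j hj => ?_
    rw [if_neg (ne_of_mem_of_not_mem hj hη), inner_smul_right, mul_comm]
  -- The right-hand side `z` is, up to a multiple of the unit vector at `η`, in the image under `G`
  -- of a vector vanishing at `η`, so that Cramer's rule leaves only the minor of `τ`.
  have hz : (fun i : σ => z i) = G.mulVec x + φ • Pi.single e 1 := by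
    ext i
    simp only [Pi.add_apply, hGx, Pi.smul_apply, smul_eq_mul]
    by_cases hi : i = e
    · subst hi
      simp [hφ, he]
    · have hiτ : (i : ι) ∈ τ :=
        (Finset.mem_insert.1 i.2).resolve_left fun h => hi (Subtype.ext h)
      rw [F.inner_vertex hτ z hiτ, Pi.single_eq_of_ne hi, mul_zero, add_zero]
  have hblock : G.cramer (Pi.single e 1) e = (F.gram τ).det := by
    rw [Matrix.cramer_apply, Matrix.twoBlockTriangular_det _ (fun i : σ => (i : ι) = η)]
    · let E : τ ≃ {i : σ // ¬ (i : ι) = η} :=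
        { toFun := fun i => ⟨⟨i, Finset.mem_insert_of_mem i.2⟩, ne_of_mem_of_not_mem i.2 hη⟩
          invFun := fun i => ⟨i.1, (Finset.mem_insert.1 i.1.2).resolve_left i.2⟩
          left_inv := fun _ => rfl
          right_inv := fun _ => rfl }
      refine (congrArg₂ (· * ·) (?_ : _ = (1 : ℝ)) ?_).trans (one_mul _)
      · have : Subsingleton {i : σ // (i : ι) = η} :=
          ⟨fun a b => Subtype.ext (Subtype.ext (a.2.trans b.2.symm))⟩
        rw [Matrix.det_eq_elem_of_subsingleton _ ⟨e, rfl⟩]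
        simp only [Matrix.toSquareBlockProp_def, Matrix.of_apply]
        rw [Matrix.updateCol_self, Pi.single_eq_same]
      rw [← Matrix.det_submatrix_equiv_self E]
      congr 1
      ext i j
      simp only [Matrix.toSquareBlockProp_def, Matrix.submatrix_apply, Matrix.of_apply]
      rw [Matrix.updateCol_ne fun h => (E j).2 (congrArg Subtype.val h)]
      rfl
    · intro i hi j hj
      obtain rfl : j = e := Subtype.ext hj
      rw [Matrix.updateCol_self, Pi.single_eq_of_ne fun h => hi (congrArg Subtype.val h)]
  have h0 : (F.gramReplace σ η z).det = φ * (F.gram τ).det := by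
    rw [F.det_gramReplace σ e z, hz, map_add, map_smul,
      Matrix.cramer_eq_adjugate_mulVec G (G.mulVec x), Matrix.mulVec_mulVec,
      Matrix.adjugate_mul, Matrix.smul_mulVec, Matrix.one_mulVec]
    have hxe : x e = 0 := if_pos rfl
    simp only [Pi.add_apply, Pi.smul_apply, smul_eq_mul, hxe, mul_zero, zero_add]
    rw [← hblock]
  rw [coord, ← hG, div_mul_cancel₀ _ hd, h0]

end Gram

/-! ### Balanced weights and the action of piecewise linear functions -/

section Balanced

variable {V ι : Type*} [NormedAddCommGroup V] [InnerProductSpace ℝ V] [Fintype ι] [DecidableEq ι]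

/-- The space of balanced weights (Minkowski weights) of all dimensions at once: functions `c` on
the cones of the fan, extended by zero, with `∑ c(τ ∪ η) u_η` in the span of `τ` for each cone `τ`,
where `η` runs over the rays outside `τ`. -/
def balancedWeights (F : SimplicialFan V ι) : Submodule ℝ (Finset ι → ℝ) where
  carrier := {c | (∀ σ, σ ∉ F.cones → c σ = 0) ∧
    ∀ τ ∈ F.cones, ∑ η ∈ τᶜ, c (insert η τ) • F.u η ∈ F.spanR τ}
  zero_mem' := ⟨fun _ _ => rfl, fun _ _ => by simp⟩
  add_mem' := by
    rintro a b ⟨ha, ha'⟩ ⟨hb, hb'⟩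
    refine ⟨fun σ hσ => by simp [ha σ hσ, hb σ hσ], fun τ hτ => ?_⟩
    simp only [Pi.add_apply, add_smul, Finset.sum_add_distrib]
    exact Submodule.add_mem _ (ha' τ hτ) (hb' τ hτ)
  smul_mem' := by
    rintro r a ⟨ha, ha'⟩
    refine ⟨fun σ hσ => by simp [ha σ hσ], fun τ hτ => ?_⟩
    simp only [Pi.smul_apply, smul_assoc, ← Finset.smul_sum]
    exact Submodule.smul_mem _ _ (ha' τ hτ)

/-- The divisor on the weight `c` of the piecewise linear function with values `z` at the ray
generators: its value at `τ` is `∑ c(τ ∪ η) (z_η - w_τ * u_η)`, where `w_τ` is the vertex of `τ`. -/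
def divisor (F : SimplicialFan V ι) (z : ι → ℝ) (c : Finset ι → ℝ) (τ : Finset ι) : ℝ :=
  ∑ η ∈ τᶜ, c (insert η τ) * (z η - ⟪F.vertex τ z, F.u η⟫_ℝ)

theorem divisor_of_not_mem (F : SimplicialFan V ι) (z : ι → ℝ) {c : Finset ι → ℝ}
    (hc : c ∈ F.balancedWeights) {τ : Finset ι} (hτ : τ ∉ F.cones) : F.divisor z c τ = 0 := by
  refine Finset.sum_eq_zero fun η _ => ?_
  rw [hc.1 _ fun h => hτ (F.face_mem _ h τ (Finset.subset_insert η τ)), zero_mul]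

/-- On a balanced weight, the vertex of `τ` in the definition of the divisor may be replaced by any
vector having the same inner products with the rays of `τ`. -/
theorem divisor_eq_of_inner_eq (F : SimplicialFan V ι) {z : ι → ℝ} {c : Finset ι → ℝ}
    (hc : c ∈ F.balancedWeights) {τ : Finset ι} (hτ : τ ∈ F.cones) {y : V}
    (hy : ∀ i ∈ τ, ⟪y, F.u i⟫_ℝ = z i) :
    F.divisor z c τ = ∑ η ∈ τᶜ, c (insert η τ) * z η -
      ⟪y, ∑ η ∈ τᶜ, c (insert η τ) • F.u η⟫_ℝ := by
  have h := F.inner_eq_zero_of_mem_spanR (y := F.vertex τ z - y)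
    (fun i hi => by rw [inner_sub_left, F.inner_vertex hτ z hi, hy i hi, sub_self]) (hc.2 τ hτ)
  rw [inner_sub_left, sub_eq_zero] at h
  rw [← h, inner_sum, divisor, ← Finset.sum_sub_distrib]
  exact Finset.sum_congr rfl fun η _ => by rw [inner_smul_right, mul_sub]

theorem divisor_eq_inner_vertex (F : SimplicialFan V ι) (z : ι → ℝ) (c : Finset ι → ℝ)
    (τ : Finset ι) :
    F.divisor z c τ = ∑ η ∈ τᶜ, c (insert η τ) * z η -
      ⟪F.vertex τ z, ∑ η ∈ τᶜ, c (insert η τ) • F.u η⟫_ℝ := by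
  rw [inner_sum, divisor, ← Finset.sum_sub_distrib]
  exact Finset.sum_congr rfl fun η _ => by rw [inner_smul_right, mul_sub]

theorem divisor_add (F : SimplicialFan V ι) (z z' : ι → ℝ) {c : Finset ι → ℝ}
    (hc : c ∈ F.balancedWeights) : F.divisor (z + z') c = F.divisor z c + F.divisor z' c := by
  ext τ
  by_cases hτ : τ ∈ F.cones
  · rw [F.divisor_eq_of_inner_eq hc hτ (y := F.vertex τ z + F.vertex τ z')
      (fun i hi => by simp [inner_add_left, F.inner_vertex hτ _ hi]), Pi.add_apply,
      divisor_eq_inner_vertex, divisor_eq_inner_vertex, inner_add_left]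
    simp only [Pi.add_apply, mul_add, Finset.sum_add_distrib]
    ring
  · simp [F.divisor_of_not_mem _ hc hτ]

theorem divisor_smul (F : SimplicialFan V ι) (r : ℝ) (z : ι → ℝ) {c : Finset ι → ℝ}
    (hc : c ∈ F.balancedWeights) : F.divisor (r • z) c = r • F.divisor z c := by
  ext τ
  by_cases hτ : τ ∈ F.cones
  · rw [F.divisor_eq_of_inner_eq hc hτ (y := r • F.vertex τ z)
      (fun i hi => by simp [real_inner_smul_left, F.inner_vertex hτ _ hi]), Pi.smul_apply,
      divisor_eq_inner_vertex, real_inner_smul_left, smul_eq_mul, mul_sub, Finset.mul_sum]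
    simp only [Pi.smul_apply, smul_eq_mul, mul_left_comm]
  · simp [F.divisor_of_not_mem _ hc hτ]

theorem divisor_weight_add (F : SimplicialFan V ι) (z : ι → ℝ) (c c' : Finset ι → ℝ) :
    F.divisor z (c + c') = F.divisor z c + F.divisor z c' := by
  ext τ
  simp only [divisor, Pi.add_apply, add_mul, Finset.sum_add_distrib]

theorem divisor_weight_smul (F : SimplicialFan V ι) (z : ι → ℝ) (r : ℝ) (c : Finset ι → ℝ) :
    F.divisor z (r • c) = r • F.divisor z c := by
  ext τ
  simp only [divisor, Pi.smul_apply, smul_eq_mul, mul_assoc, Finset.mul_sum]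

/-- A globally linear function has zero divisor on every balanced weight. -/
theorem divisor_linear (F : SimplicialFan V ι) (v : V) {c : Finset ι → ℝ}
    (hc : c ∈ F.balancedWeights) : F.divisor (fun i => ⟪v, F.u i⟫_ℝ) c = 0 := by
  ext τ
  by_cases hτ : τ ∈ F.cones
  · rw [F.divisor_eq_of_inner_eq hc hτ (y := v) (fun i _ => rfl), inner_sum]
    simp only [inner_smul_right, sub_self, Pi.zero_apply]
  · simp [F.divisor_of_not_mem _ hc hτ]

theorem divisor_sub_linear (F : SimplicialFan V ι) (z : ι → ℝ) (v : V) {c : Finset ι → ℝ}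
    (hc : c ∈ F.balancedWeights) : F.divisor (fun i => z i - ⟪v, F.u i⟫_ℝ) c = F.divisor z c := by
  have h := F.divisor_add (fun i => z i - ⟪v, F.u i⟫_ℝ) (fun i => ⟪v, F.u i⟫_ℝ) hc
  rw [F.divisor_linear v hc, add_zero] at h
  rw [← h]
  congr 1
  ext i
  simp

/-- The value of `c` on the cone spanned by `κ` and two further distinct rays, and zero if the two
rays are equal or one of them lies in `κ`. -/
def linkWeight (κ : Finset ι) (c : Finset ι → ℝ) (η θ : ι) : ℝ :=
  if η ∉ κ ∧ θ ∉ κ ∧ η ≠ θ then c (insert η (insert θ κ)) else 0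

omit [Fintype ι] in
theorem linkWeight_comm (κ : Finset ι) (c : Finset ι → ℝ) (η θ : ι) :
    linkWeight κ c η θ = linkWeight κ c θ η := by
  unfold linkWeight
  rw [Finset.insert_comm]
  exact if_congr (by tauto) rfl rfl

theorem sum_compl_insert_linkWeight {M : Type*} [AddCommGroup M] [Module ℝ M] {κ : Finset ι}
    (c : Finset ι → ℝ) {η : ι} (hη : η ∉ κ) (g : ι → M) :
    ∑ θ ∈ (insert η κ)ᶜ, c (insert θ (insert η κ)) • g θ = ∑ θ, linkWeight κ c θ η • g θ := by
  rw [← Finset.sum_subset (Finset.subset_univ (insert η κ)ᶜ)]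
  · refine Finset.sum_congr rfl fun θ hθ => ?_
    rw [Finset.mem_compl, Finset.mem_insert, not_or] at hθ
    rw [linkWeight, if_pos ⟨hθ.2, hη, hθ.1⟩]
  · intro θ _ hθ
    rw [Finset.mem_compl, not_not, Finset.mem_insert] at hθ
    rw [linkWeight, if_neg (by tauto), zero_smul]

/-- Local form of the balancing condition around `κ`: there are self-intersection numbers `a_η`
such that `∑ c(κ ∪ η ∪ θ) u_θ - a_η u_η` lies in the span of `κ`, and these compute the divisor at
`κ ∪ η` of any function vanishing on `κ`. -/
theorem exists_selfIntersection (F : SimplicialFan V ι) {c : Finset ι → ℝ}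
    (hc : c ∈ F.balancedWeights) (κ : Finset ι) :
    ∃ a : ι → ℝ, ∀ η ∉ κ, (∑ θ, linkWeight κ c θ η • F.u θ - a η • F.u η ∈ F.spanR κ) ∧
      ∀ z : ι → ℝ, (∀ i ∈ κ, z i = 0) →
        F.divisor z c (insert η κ) = ∑ θ, linkWeight κ c θ η * z θ - a η * z η := by
  suffices h : ∀ η, ∃ a : ℝ, η ∉ κ → (∑ θ, linkWeight κ c θ η • F.u θ - a • F.u η ∈ F.spanR κ) ∧
      ∀ z : ι → ℝ, (∀ i ∈ κ, z i = 0) →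
        F.divisor z c (insert η κ) = ∑ θ, linkWeight κ c θ η * z θ - a * z η by
    choose a ha using h
    exact ⟨a, ha⟩
  intro η
  by_cases hη : η ∈ κ
  · exact ⟨0, fun h => absurd hη h⟩
  by_cases hcone : insert η κ ∈ F.cones
  · have hB := hc.2 _ hcone
    rw [sum_compl_insert_linkWeight c hη, spanR, Finset.coe_insert, Set.image_insert_eq,
      Submodule.mem_span_insert] at hB
    obtain ⟨a, k, hk, hB⟩ := hB
    refine ⟨a, fun _ => ⟨by rwa [hB, add_sub_cancel_left], fun z hz => ?_⟩⟩
    have hsum := sum_compl_insert_linkWeight c hη z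
    simp only [smul_eq_mul] at hsum
    have hk0 : ⟪F.vertex (insert η κ) z, k⟫_ℝ = 0 := F.inner_eq_zero_of_mem_spanR
      (fun i hi => by rw [F.inner_vertex hcone z (Finset.mem_insert_of_mem hi), hz i hi]) hk
    rw [divisor_eq_inner_vertex, hsum, sum_compl_insert_linkWeight c hη, hB, inner_add_right, hk0,
      add_zero, inner_smul_right, F.inner_vertex hcone z (Finset.mem_insert_self η κ)]
  · have h0 : ∀ θ, linkWeight κ c θ η = 0 := by
      intro θ
      unfold linkWeight
      split_ifs
      · exact hc.1 _ fun h => hcone (F.face_mem _ h _ (Finset.subset_insert _ _))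
      · rfl
    refine ⟨0, fun _ => ⟨by simp [h0], fun z _ => ?_⟩⟩
    rw [F.divisor_of_not_mem z hc hcone]
    simp [h0]

omit [Fintype ι] in
theorem linkWeight_of_mem_right {κ : Finset ι} (c : Finset ι → ℝ) {η θ : ι} (h : θ ∈ κ) :
    linkWeight κ c η θ = 0 :=
  if_neg (by tauto)

/-- Divisors of piecewise linear functions on balanced weights are balanced. -/
theorem divisor_mem_balancedWeights (F : SimplicialFan V ι) (z : ι → ℝ) {c : Finset ι → ℝ}
    (hc : c ∈ F.balancedWeights) : F.divisor z c ∈ F.balancedWeights := by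
  refine ⟨fun σ hσ => F.divisor_of_not_mem z hc hσ, fun κ hκ => ?_⟩
  -- Subtracting a linear function, `z` may be assumed to vanish on `κ`.
  wlog hz : ∀ i ∈ κ, z i = 0 generalizing z
  · rw [← F.divisor_sub_linear z (F.vertex κ z) hc]
    exact this _ fun i hi => by rw [F.inner_vertex hκ z hi, sub_self]
  obtain ⟨a, ha⟩ := F.exists_selfIntersection hc κ
  have key : ∑ η ∈ κᶜ, F.divisor z c (insert η κ) • F.u η =
      ∑ θ ∈ κᶜ, z θ • (∑ η, linkWeight κ c η θ • F.u η - a θ • F.u θ) := by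
    have h1 : ∀ η ∈ κᶜ, F.divisor z c (insert η κ) • F.u η =
        ∑ θ, (linkWeight κ c θ η * z θ) • F.u η - (a η * z η) • F.u η := fun η hη => by
      rw [(ha η (Finset.mem_compl.1 hη)).2 z hz, sub_smul, Finset.sum_smul]
    have h2 : ∀ θ ∈ κᶜ, z θ • (∑ η, linkWeight κ c η θ • F.u η - a θ • F.u θ) =
        ∑ η, (linkWeight κ c θ η * z θ) • F.u η - (a θ * z θ) • F.u θ := fun θ _ => by
      rw [smul_sub, Finset.smul_sum, smul_smul, mul_comm (a θ)]
      congr 1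
      exact Finset.sum_congr rfl fun η _ => by rw [smul_smul, mul_comm, linkWeight_comm]
    rw [Finset.sum_congr rfl h1, Finset.sum_congr rfl h2, Finset.sum_sub_distrib,
      Finset.sum_sub_distrib]
    congr 1
    rw [Finset.sum_subset (Finset.subset_univ κᶜ), Finset.sum_subset (Finset.subset_univ κᶜ),
      Finset.sum_comm]
    · intro θ _ hθ
      rw [Finset.mem_compl, not_not] at hθ
      simp [hz θ hθ]
    · intro η _ hη
      rw [Finset.mem_compl, not_not] at hη
      simp [linkWeight_of_mem_right c hη]
  rw [key]
  exact Submodule.sum_mem _ fun θ hθ =>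
    Submodule.smul_mem _ _ (ha θ (Finset.mem_compl.1 hθ)).1

/-- Taking divisors of two piecewise linear functions is independent of the order. -/
theorem divisor_comm (F : SimplicialFan V ι) (y z : ι → ℝ) {c : Finset ι → ℝ}
    (hc : c ∈ F.balancedWeights) :
    F.divisor y (F.divisor z c) = F.divisor z (F.divisor y c) := by
  ext κ
  by_cases hκ : κ ∈ F.cones
  swap
  · rw [F.divisor_of_not_mem _ (F.divisor_mem_balancedWeights z hc) hκ,
      F.divisor_of_not_mem _ (F.divisor_mem_balancedWeights y hc) hκ]
  -- Subtracting linear functions, both `z` and `y` may be assumed to vanish on `κ`.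
  wlog hz : ∀ i ∈ κ, z i = 0 generalizing z
  · rw [← F.divisor_sub_linear z (F.vertex κ z) hc,
      ← F.divisor_sub_linear z (F.vertex κ z) (F.divisor_mem_balancedWeights y hc)]
    exact this _ fun i hi => by rw [F.inner_vertex hκ z hi, sub_self]
  wlog hy : ∀ i ∈ κ, y i = 0 generalizing y
  · rw [← F.divisor_sub_linear y (F.vertex κ y) hc,
      ← F.divisor_sub_linear y (F.vertex κ y) (F.divisor_mem_balancedWeights z hc)]
    exact this _ fun i hi => by rw [F.inner_vertex hκ y hi, sub_self]
  obtain ⟨a, ha⟩ := F.exists_selfIntersection hc κ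
  have expand : ∀ p q : ι → ℝ, (∀ i ∈ κ, p i = 0) → (∀ i ∈ κ, q i = 0) →
      F.divisor p (F.divisor q c) κ =
        ∑ η, ∑ θ, linkWeight κ c θ η * q θ * p η - ∑ η ∈ κᶜ, a η * q η * p η := by
    intro p q hp hq
    rw [F.divisor_eq_of_inner_eq (F.divisor_mem_balancedWeights q hc) hκ (y := 0)
      (fun i hi => by rw [inner_zero_left, hp i hi]), inner_zero_left, sub_zero,
      ← Finset.sum_subset (Finset.subset_univ κᶜ), ← Finset.sum_sub_distrib]
    · refine Finset.sum_congr rfl fun η hη => ?_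
      rw [(ha η (Finset.mem_compl.1 hη)).2 q hq, sub_mul, Finset.sum_mul]
    · intro η _ hη
      rw [Finset.mem_compl, not_not] at hη
      simp [hp η hη]
  rw [expand y z hy hz, expand z y hz hy, Finset.sum_comm]
  congr 1
  · refine Finset.sum_congr rfl fun η _ => Finset.sum_congr rfl fun θ _ => ?_
    rw [linkWeight_comm]
    ring
  · exact Finset.sum_congr rfl fun η _ => by ring

/-- The operator on balanced weights that takes the divisor of the piecewise linear function with
values `z` at the ray generators, as a linear function of `z`. -/
def divisorHom (F : SimplicialFan V ι) :
    (ι → ℝ) →ₗ[ℝ] Module.End ℝ F.balancedWeights where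
  toFun z :=
    { toFun := fun c => ⟨F.divisor z c, F.divisor_mem_balancedWeights z c.2⟩
      map_add' := fun a b => Subtype.ext (F.divisor_weight_add z a b)
      map_smul' := fun r a => Subtype.ext (F.divisor_weight_smul z r a) }
  map_add' z z' := LinearMap.ext fun c => Subtype.ext (F.divisor_add z z' c.2)
  map_smul' r z := LinearMap.ext fun c => Subtype.ext (F.divisor_smul r z c.2)

@[simp]
theorem coe_divisorHom_apply (F : SimplicialFan V ι) (z : ι → ℝ) (c : F.balancedWeights) :
    (F.divisorHom z c : Finset ι → ℝ) = F.divisor z c := rfl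

theorem divisorHom_mul_comm (F : SimplicialFan V ι) (y z : ι → ℝ) :
    F.divisorHom y * F.divisorHom z = F.divisorHom z * F.divisorHom y :=
  LinearMap.ext fun c => Subtype.ext (F.divisor_comm y z c.2)

/-- As the divisor operators commute, balanced weights form a module over the polynomial ring, on
which the variable of the ray `i` takes the divisor of the Courant function of `i`. -/
theorem exists_polynomialAction (F : SimplicialFan V ι) :
    ∃ Ψ : MvPolynomial ι ℝ →ₐ[ℝ] Module.End ℝ F.balancedWeights,
      ∀ i, Ψ (MvPolynomial.X i) = F.divisorHom (Pi.single i 1) := by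
  set s : Set (Module.End ℝ F.balancedWeights) :=
    Set.range fun i : ι => F.divisorHom (Pi.single i 1) with hs
  have hcomm := Algebra.isMulCommutative_adjoin ℝ (s := s) (by
    rintro _ ⟨i, rfl⟩ _ ⟨j, rfl⟩
    exact F.divisorHom_mul_comm _ _)
  let _ : CommSemiring (Algebra.adjoin ℝ s) :=
    { (Algebra.adjoin ℝ s).toSemiring with mul_comm := hcomm.is_comm.comm }
  let g : ι → Algebra.adjoin ℝ s := fun i =>
    ⟨F.divisorHom (Pi.single i 1), Algebra.subset_adjoin ⟨i, rfl⟩⟩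
  refine ⟨(Algebra.adjoin ℝ s).val.comp (MvPolynomial.aeval g), fun i => ?_⟩
  rw [AlgHom.comp_apply, MvPolynomial.aeval_X]
  rfl

/-- The action of the polynomial ring `ℝ[x_ρ]` on balanced weights by divisors. -/
def polynomialAction (F : SimplicialFan V ι) :
    MvPolynomial ι ℝ →ₐ[ℝ] Module.End ℝ F.balancedWeights :=
  F.exists_polynomialAction.choose

theorem polynomialAction_X (F : SimplicialFan V ι) (i : ι) :
    F.polynomialAction (MvPolynomial.X i) = F.divisorHom (Pi.single i 1) :=
  F.exists_polynomialAction.choose_spec i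

theorem polynomialAction_linearForm (F : SimplicialFan V ι) (z : ι → ℝ) :
    F.polynomialAction (∑ i, MvPolynomial.C (z i) * MvPolynomial.X i) = F.divisorHom z := by
  conv_rhs => rw [pi_eq_sum_univ' z]
  simp only [map_sum, map_smul, ← MvPolynomial.smul_eq_C_mul, polynomialAction_X]

theorem divisor_single (F : SimplicialFan V ι) {i : ι} {c : Finset ι → ℝ}
    (hc : c ∈ F.balancedWeights) {τ : Finset ι} (hi : i ∉ τ) :
    F.divisor (Pi.single i 1) c τ = c (insert i τ) := by
  by_cases hτ : τ ∈ F.cones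
  · rw [F.divisor_eq_of_inner_eq hc hτ (y := 0)
      (fun j hj => by rw [inner_zero_left, Pi.single_eq_of_ne (ne_of_mem_of_not_mem hj hi)]),
      inner_zero_left, sub_zero, Finset.sum_eq_single i]
    · simp
    · intro j _ hj
      simp [hj]
    · intro h
      simp [hi] at h
  · rw [F.divisor_of_not_mem _ hc hτ,
      hc.1 _ fun h => hτ (F.face_mem _ h τ (Finset.subset_insert i τ))]

/-- A squarefree monomial acts by shifting weights along the cone it corresponds to. -/
theorem polynomialAction_prod_X (F : SimplicialFan V ι) (s τ : Finset ι) (hd : Disjoint s τ)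
    (c : F.balancedWeights) :
    (F.polynomialAction (∏ i ∈ s, MvPolynomial.X i) c : Finset ι → ℝ) τ =
      (c : Finset ι → ℝ) (s ∪ τ) := by
  induction s using Finset.induction_on generalizing τ c with
  | empty => simp
  | insert i s hi ih =>
    rw [Finset.disjoint_insert_left] at hd
    rw [Finset.prod_insert hi, map_mul, polynomialAction_X, Module.End.mul_apply,
      coe_divisorHom_apply, F.divisor_single (Subtype.prop _) hd.1, ih, Finset.union_insert,
      Finset.insert_union]
    exact Finset.disjoint_insert_right.2 ⟨hi, hd.2⟩

theorem polynomialAction_of_mem_idealJ [FiniteDimensional ℝ V] (F : SimplicialFan V ι)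
    {p : MvPolynomial ι ℝ} (hp : p ∈ F.idealJ) : F.polynomialAction p = 0 := by
  suffices h : F.idealJ ≤ RingHom.ker F.polynomialAction from h hp
  refine Ideal.span_le.2 ?_
  rintro _ ⟨v, rfl⟩
  rw [SetLike.mem_coe, RingHom.mem_ker, polynomialAction_linearForm F fun i => v (F.u i)]
  refine LinearMap.ext fun c => Subtype.ext ?_
  have hv : (fun i => v (F.u i)) = fun i =>
      ⟪(InnerProductSpace.toDual ℝ V).symm (LinearMap.toContinuousLinearMap v), F.u i⟫_ℝ := by
    ext i
    rw [InnerProductSpace.toDual_symm_apply]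
    rfl
  rw [coe_divisorHom_apply, hv, F.divisor_linear _ c.2]
  rfl

theorem polynomialAction_of_mem_idealI (F : SimplicialFan V ι)
    {p : MvPolynomial ι ℝ} (hp : p ∈ F.idealI) (c : F.balancedWeights) :
    (F.polynomialAction p c : Finset ι → ℝ) ∅ = 0 := by
  induction hp using Submodule.span_induction generalizing c with
  | mem x hx =>
    obtain ⟨s, hs, rfl⟩ := hx
    rw [F.polynomialAction_prod_X s ∅ (Finset.disjoint_empty_right s), Finset.union_empty]
    exact c.2.1 s hs
  | zero => simp
  | add x y _ _ hx hy => simp [hx, hy]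
  | smul a x _ hx =>
    rw [smul_eq_mul, mul_comm, map_mul, Module.End.mul_apply, hx]

/-- A balanced weight `c` defines a linear functional on the Chow ring: the value at the zero cone
of the action on `c`. -/
theorem exists_chowRing_functional [FiniteDimensional ℝ V] (F : SimplicialFan V ι)
    (c : F.balancedWeights) :
    ∃ φ : F.ChowRing →ₗ[ℝ] ℝ, ∀ p : MvPolynomial ι ℝ,
      φ (Ideal.Quotient.mk _ p) = (F.polynomialAction p c : Finset ι → ℝ) ∅ := by
  let ψ : MvPolynomial ι ℝ →ₗ[ℝ] ℝ :=
    { toFun := fun p => (F.polynomialAction p c : Finset ι → ℝ) ∅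
      map_add' := fun p q => by simp
      map_smul' := fun r p => by simp }
  let π := (Ideal.Quotient.mkₐ ℝ (F.idealI ⊔ F.idealJ)).toLinearMap
  have hψ : ψ ∈ LinearMap.range π.dualMap := by
    rw [LinearMap.range_dualMap_eq_dualAnnihilator_ker, Submodule.mem_dualAnnihilator]
    intro p hp
    have hp' : p ∈ F.idealI ⊔ F.idealJ := Ideal.Quotient.eq_zero_iff_mem.1 hp
    obtain ⟨a, ha, b, hb, rfl⟩ := Submodule.mem_sup.1 hp'
    rw [map_add]
    change (F.polynomialAction a c : Finset ι → ℝ) ∅ + (F.polynomialAction b c : Finset ι → ℝ) ∅ = 0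
    rw [F.polynomialAction_of_mem_idealI ha, F.polynomialAction_of_mem_idealJ hb]
    simp
  obtain ⟨φ, hφ⟩ := hψ
  exact ⟨φ, fun p => LinearMap.congr_fun hφ p⟩

/-- The weight `ω` on the `d`-dimensional cones, extended by zero. -/
def topWeight (F : SimplicialFan V ι) (d : ℕ) (ω : Finset ι → ℝ) (σ : Finset ι) : ℝ :=
  if σ ∈ F.conesOfDim d then ω σ else 0

theorem topWeight_mem_balancedWeights (F : SimplicialFan V ι) {d : ℕ} {ω : Finset ι → ℝ}
    (hF : F.IsTropical d ω) : F.topWeight d ω ∈ F.balancedWeights := by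
  refine ⟨fun σ hσ => if_neg fun h => hσ (Finset.mem_filter.1 h).1, fun τ hτ => ?_⟩
  by_cases hd : τ.card + 1 = d
  · have hb := hF.balanced τ hτ hd
    have key : ∑ η ∈ τᶜ, F.topWeight d ω (insert η τ) • F.u η =
        ∑ σ ∈ F.conesOfDim d with τ ⊆ σ, ω σ • ∑ i ∈ σ \ τ, F.u i := by
      simp only [topWeight, ite_smul, zero_smul]
      rw [← Finset.sum_filter]
      refine Finset.sum_bij (fun η _ => insert η τ) ?_ ?_ ?_ ?_
      · intro η hη
        rw [Finset.mem_filter] at hη ⊢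
        exact ⟨hη.2, Finset.subset_insert η τ⟩
      · intro η hη θ hθ h
        rw [Finset.mem_filter, Finset.mem_compl] at hη hθ
        have : η ∈ insert θ τ := h ▸ Finset.mem_insert_self η τ
        exact (Finset.mem_insert.1 this).resolve_right hη.1
      · intro σ hσ
        rw [Finset.mem_filter] at hσ
        have hcard : (σ \ τ).card = 1 := by
          have h1 := Finset.card_sdiff_add_card_eq_card hσ.2
          have h2 := (Finset.mem_filter.1 hσ.1).2
          omega
        obtain ⟨η, hη⟩ := Finset.card_eq_one.1 hcard
        have hσ' : insert η τ = σ := by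
          rw [Finset.insert_eq, ← hη, Finset.sdiff_union_of_subset hσ.2]
        have hη' : η ∈ σ \ τ := hη ▸ Finset.mem_singleton_self η
        refine ⟨η, ?_, hσ'⟩
        rw [Finset.mem_filter, Finset.mem_compl, hσ']
        exact ⟨(Finset.mem_sdiff.1 hη').2, hσ.1⟩
      · intro η hη
        rw [Finset.mem_filter, Finset.mem_compl] at hη
        rw [Finset.insert_sdiff_of_notMem _ hη.1, Finset.sdiff_self, insert_empty_eq,
          Finset.sum_singleton]
    rwa [key]
  · rw [Finset.sum_eq_zero]
    · exact Submodule.zero_mem _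
    · intro η hη
      rw [topWeight, if_neg, zero_smul]
      intro h
      apply hd
      rw [← (Finset.mem_filter.1 h).2, Finset.card_insert_of_notMem (Finset.mem_compl.1 hη)]

end Balanced

/-! ### Generation of the Chow ring by the classes of cones -/

section Generation

variable {V ι : Type*} [NormedAddCommGroup V] [InnerProductSpace ℝ V] [Fintype ι] [DecidableEq ι]

theorem prod_divX_eq_zero (F : SimplicialFan V ι) {s : Finset ι} (hs : s ∉ F.cones) :
    ∏ i ∈ s, F.divX i = 0 := by
  simp only [divX]
  rw [← map_prod, Ideal.Quotient.eq_zero_iff_mem]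
  exact Ideal.mem_sup_left (Ideal.subset_span ⟨s, hs, rfl⟩)

theorem sum_inner_smul_divX (F : SimplicialFan V ι) (v : V) :
    ∑ i, ⟪v, F.u i⟫_ℝ • F.divX i = 0 := by
  have h : Ideal.Quotient.mk (F.idealI ⊔ F.idealJ)
      (∑ i, MvPolynomial.C (⟪v, F.u i⟫_ℝ) * MvPolynomial.X i) = 0 := by
    rw [Ideal.Quotient.eq_zero_iff_mem]
    exact Ideal.mem_sup_right (Ideal.subset_span ⟨innerₛₗ ℝ v, rfl⟩)
  rw [← h, map_sum]
  refine Finset.sum_congr rfl fun i _ => ?_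
  rw [← MvPolynomial.smul_eq_C_mul]
  rfl

/-- Multiplying the class of a cone with a divisor gives a combination of classes of cones of one
dimension more: a ray of the cone is moved off it by a linear relation. -/
theorem divX_mul_prod_mem_span (F : SimplicialFan V ι) {k : ℕ} (i : ι) {τ : Finset ι}
    (hτ : τ ∈ F.conesOfDim k) :
    F.divX i * ∏ j ∈ τ, F.divX j ∈
      Submodule.span ℝ
        ((fun σ => ∏ j ∈ σ, F.divX j) '' (F.conesOfDim (k + 1) : Set (Finset ι))) := by
  obtain ⟨hτc, hτk⟩ := Finset.mem_filter.1 hτ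
  have hout : ∀ j ∉ τ, F.divX j * ∏ l ∈ τ, F.divX l ∈ Submodule.span ℝ
      ((fun σ => ∏ j ∈ σ, F.divX j) '' (F.conesOfDim (k + 1) : Set (Finset ι))) := by
    intro j hj
    rw [← Finset.prod_insert hj]
    by_cases hc : insert j τ ∈ F.cones
    · refine Submodule.subset_span ⟨insert j τ, ?_, rfl⟩
      exact Finset.mem_filter.2 ⟨hc, by rw [Finset.card_insert_of_notMem hj, hτk]⟩
    · rw [F.prod_divX_eq_zero hc]
      exact Submodule.zero_mem _
  by_cases hi : i ∈ τ
  · have hrel := congrArg (· * ∏ l ∈ τ, F.divX l)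
      (F.sum_inner_smul_divX (F.vertex τ (Pi.single i 1)))
    simp only [zero_mul, Finset.sum_mul, smul_mul_assoc] at hrel
    rw [← Finset.sum_add_sum_compl τ, Finset.sum_eq_single_of_mem i hi, F.inner_vertex hτc _ hi,
      Pi.single_eq_same, one_smul] at hrel
    · rw [eq_neg_of_add_eq_zero_left hrel]
      exact Submodule.neg_mem _ (Submodule.sum_mem _ fun j hj =>
        Submodule.smul_mem _ _ (hout j (Finset.mem_compl.1 hj)))
    · intro j hj hji
      rw [F.inner_vertex hτc _ hj, Pi.single_eq_of_ne hji, zero_smul]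
  · exact hout i hi

theorem prod_map_divX_mem_span (F : SimplicialFan V ι) (s : Multiset ι) :
    (s.map F.divX).prod ∈ Submodule.span ℝ
      ((fun σ => ∏ j ∈ σ, F.divX j) '' (F.conesOfDim s.card : Set (Finset ι))) := by
  induction s using Multiset.induction_on with
  | empty => exact Submodule.subset_span ⟨∅, Finset.mem_filter.2 ⟨F.empty_mem, by simp⟩, by simp⟩
  | cons i s ih =>
    rw [Multiset.map_cons, Multiset.prod_cons, Multiset.card_cons]
    refine Submodule.span_induction ?_ (by simp) (fun a b _ _ ha hb => ?_) (fun c a _ ha => ?_) ih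
    · rintro _ ⟨τ, hτ, rfl⟩
      exact F.divX_mul_prod_mem_span i hτ
    · rw [mul_add]
      exact Submodule.add_mem _ ha hb
    · rw [mul_smul_comm]
      exact Submodule.smul_mem _ _ ha

/-- The classes of the `k`-dimensional cones generate the degree `k` part of the Chow ring. -/
theorem chowGr_le_span (F : SimplicialFan V ι) (k : ℕ) :
    F.chowGr k ≤ Submodule.span ℝ
      ((fun σ => ∏ j ∈ σ, F.divX j) '' (F.conesOfDim k : Set (Finset ι))) := by
  rintro _ ⟨p, hp, rfl⟩
  have hp' : p.IsHomogeneous k := hp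
  rw [p.as_sum, map_sum]
  refine Submodule.sum_mem _ fun m hm => ?_
  have hdeg : Finsupp.degree m = k := by
    rw [Finsupp.degree_eq_weight_one]
    exact hp' (MvPolynomial.mem_support_iff.1 hm)
  have hcard : (Finsupp.toMultiset m).card = k := by
    rw [Finsupp.card_toMultiset, ← hdeg]
    rfl
  have h := F.prod_map_divX_mem_span (Finsupp.toMultiset m)
  rw [hcard] at h
  have hm : (Ideal.Quotient.mkₐ ℝ (F.idealI ⊔ F.idealJ)).toLinearMap
      (MvPolynomial.monomial m (p.coeff m)) =
      p.coeff m • ((Finsupp.toMultiset m).map F.divX).prod := by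
    rw [Finsupp.toMultiset_map, Finsupp.prod_toMultiset, MvPolynomial.monomial_eq,
      ← MvPolynomial.smul_eq_C_mul, map_smul, AlgHom.toLinearMap_apply,
      Finsupp.prod_mapDomain_index,
      map_finsuppProd]
    · rfl
    · simp
    · intro b m₁ m₂
      rw [pow_add]
  rw [hm]
  exact Submodule.smul_mem _ _ h

theorem IsDegreeMap.unique {F : SimplicialFan V ι} {d : ℕ} {ω : Finset ι → ℝ}
    {deg deg' : F.chowGr d →ₗ[ℝ] ℝ} (h : F.IsDegreeMap d ω deg) (h' : F.IsDegreeMap d ω deg') :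
    deg = deg' := by
  suffices hs : ∀ x ∈ Submodule.span ℝ
      ((fun σ => ∏ j ∈ σ, F.divX j) '' (F.conesOfDim d : Set (Finset ι))),
      ∃ hx : x ∈ F.chowGr d, deg ⟨x, hx⟩ = deg' ⟨x, hx⟩ from
    LinearMap.ext fun x => (hs x (F.chowGr_le_span d x.2)).2
  intro x hx
  induction hx using Submodule.span_induction with
  | mem x hx =>
    obtain ⟨σ, hσ, rfl⟩ := hx
    exact ⟨F.prod_divX_mem_chowGr hσ, (h σ hσ).trans (h' σ hσ).symm⟩
  | zero => exact ⟨Submodule.zero_mem _, (map_zero deg).trans (map_zero deg').symm⟩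
  | add x y _ _ hx hy =>
    obtain ⟨hx, hx'⟩ := hx
    obtain ⟨hy, hy'⟩ := hy
    refine ⟨Submodule.add_mem _ hx hy, ?_⟩
    have e : (⟨x + y, Submodule.add_mem _ hx hy⟩ : F.chowGr d) = ⟨x, hx⟩ + ⟨y, hy⟩ := rfl
    rw [e, map_add, map_add, hx', hy']
  | smul r x _ hx =>
    obtain ⟨hx, hx'⟩ := hx
    refine ⟨Submodule.smul_mem _ r hx, ?_⟩
    have e : (⟨r • x, Submodule.smul_mem _ r hx⟩ : F.chowGr d) = r • ⟨x, hx⟩ := rfl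
    rw [e, map_smul, map_smul, hx']

/-- The degree map of a tropical fan is the action on the weight `ω`, evaluated at the zero cone. -/
theorem exists_degreeMap [FiniteDimensional ℝ V] (F : SimplicialFan V ι) {d : ℕ}
    {ω : Finset ι → ℝ} (hF : F.IsTropical d ω) :
    ∃ deg : F.chowGr d →ₗ[ℝ] ℝ, F.IsDegreeMap d ω deg ∧
      ∀ (p : MvPolynomial ι ℝ) (x : F.chowGr d), Ideal.Quotient.mk _ p = (x : F.ChowRing) →
        deg x = (F.polynomialAction p ⟨F.topWeight d ω, F.topWeight_mem_balancedWeights hF⟩ :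
          Finset ι → ℝ) ∅ := by
  obtain ⟨φ, hφ⟩ := F.exists_chowRing_functional ⟨_, F.topWeight_mem_balancedWeights hF⟩
  refine ⟨φ.domRestrict _, fun σ hσ => ?_, fun p x hx => (congrArg φ hx.symm).trans (hφ p)⟩
  have h := hφ (∏ i ∈ σ, MvPolynomial.X i)
  rw [F.polynomialAction_prod_X σ ∅ (Finset.disjoint_empty_right σ), Finset.union_empty,
    map_prod] at h
  exact h.trans (if_pos hσ)

end Generation

/-! ### The volume polynomial as a sum over ordered cones -/

section Orderings

variable {V ι : Type*} [NormedAddCommGroup V] [InnerProductSpace ℝ V] [DecidableEq ι]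

/-- The sum over all orderings `f` of the rays of `σ` of the products of the coefficients of
`u_{f(j)}` in the vertex of the face `σ(f,j)`. -/
def orderingSum (F : SimplicialFan V ι) (d : ℕ) (σ : Finset ι) (z : ι → ℝ) : ℝ :=
  ∑ f : Fin d ≃ σ, ∏ j : Fin d, F.coord (orderedFace f j) z (f j)

theorem gramSum_eq_det_mul_orderingSum (F : SimplicialFan V ι) (d : ℕ) (σ : Finset ι)
    (z : ι → ℝ) : F.gramSum d σ z = (F.gram σ).det * F.orderingSum d σ z := rfl

theorem snoc_isOrdering_iff {d : ℕ} {σ : Finset ι} {g : Fin d → ι} {η : ι} :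
    (Function.Injective (Fin.snoc g η : Fin (d + 1) → ι) ∧
      Finset.univ.image (Fin.snoc g η : Fin (d + 1) → ι) = σ) ↔
    η ∈ σ ∧ Function.Injective g ∧ Finset.univ.image g = σ.erase η := by
  have himg : Finset.univ.image (Fin.snoc g η : Fin (d + 1) → ι) =
      insert η (Finset.univ.image g) := by
    rw [← Finset.coe_inj]
    simp [Fin.range_snoc]
  rw [Fin.snoc_injective_iff, himg]
  constructor
  · rintro ⟨⟨hg, hη⟩, rfl⟩
    refine ⟨Finset.mem_insert_self _ _, hg, ?_⟩
    rw [Finset.erase_insert]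
    simpa using hη
  · rintro ⟨hη, hg, h⟩
    refine ⟨⟨hg, ?_⟩, by rw [h, Finset.insert_erase hη]⟩
    rintro ⟨i, rfl⟩
    have : g i ∈ σ.erase (g i) := h ▸ Finset.mem_image_of_mem g (Finset.mem_univ i)
    simp at this

theorem gramSum_zero_empty (F : SimplicialFan V ι) (z : ι → ℝ) : F.gramSum 0 ∅ z = 1 := by
  let _ : Unique (Fin 0 ≃ (∅ : Finset ι)) :=
    ⟨⟨Equiv.equivOfIsEmpty _ _⟩, fun _ => Subsingleton.elim _ _⟩
  rw [gramSum, Fintype.sum_unique, Fin.prod_univ_zero, Matrix.det_isEmpty, one_mul]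

variable [Fintype ι]

theorem sum_equiv_eq_sum_filter {d : ℕ} (σ : Finset ι) (Φ : (Fin d → ι) → ℝ) :
    ∑ f : Fin d ≃ σ, Φ (fun i => f i) =
      ∑ g : Fin d → ι with Function.Injective g ∧ Finset.univ.image g = σ, Φ g := by
  refine Finset.sum_bij (fun f _ i => (f i : ι)) ?_ ?_ ?_ (fun _ _ => rfl)
  · intro f _
    refine Finset.mem_filter.2 ⟨Finset.mem_univ _, Subtype.val_injective.comp f.injective, ?_⟩
    ext i
    simp only [Finset.mem_image, Finset.mem_univ, true_and]
    exact ⟨fun ⟨j, hj⟩ => hj ▸ (f j).2, fun hi => ⟨f.symm ⟨i, hi⟩, by simp⟩⟩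
  · intro f _ g _ h
    ext i
    exact congrFun h i
  · intro g hg
    obtain ⟨hinj, himg⟩ := (Finset.mem_filter.1 hg).2
    have hmem : ∀ i, g i ∈ σ := fun i => himg ▸ Finset.mem_image_of_mem g (Finset.mem_univ i)
    refine ⟨Equiv.ofBijective (fun i => ⟨g i, hmem i⟩) ⟨fun a b h => ?_, fun x => ?_⟩,
      Finset.mem_univ _, rfl⟩
    · exact hinj (congrArg Subtype.val h)
    · obtain ⟨i, _, hi⟩ := Finset.mem_image.1 (himg.symm ▸ x.2 : (x : ι) ∈ Finset.univ.image g)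
      exact ⟨i, Subtype.ext hi⟩

/-- Splitting the orderings of `σ` according to the last ray. -/
theorem orderingSum_succ (F : SimplicialFan V ι) (d : ℕ) (σ : Finset ι) (z : ι → ℝ) :
    F.orderingSum (d + 1) σ z =
      ∑ η ∈ σ, F.coord σ z η * F.orderingSum d (σ.erase η) z := by
  have hL := sum_equiv_eq_sum_filter σ
    (fun g : Fin (d + 1) → ι => ∏ j, F.coord ((Finset.Iic j).image g) z (g j))
  have hR := fun η => sum_equiv_eq_sum_filter (σ.erase η)
    (fun g : Fin d → ι => ∏ j, F.coord ((Finset.Iic j).image g) z (g j))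
  have hsplit : ∀ Φ : (Fin (d + 1) → ι) → ℝ,
      ∑ g, Φ g = ∑ η, ∑ g : Fin d → ι, Φ (Fin.snoc g η) := fun Φ => by
    rw [← (Fin.snocEquiv fun _ : Fin (d + 1) => ι).sum_comp, Fintype.sum_prod_type]
    rfl
  refine hL.trans ?_
  rw [Finset.sum_filter, hsplit, ← Finset.sum_subset (Finset.subset_univ σ)]
  · refine Finset.sum_congr rfl fun η hη => ?_
    refine Eq.trans ?_ (congrArg (F.coord σ z η * ·) (hR η).symm)
    rw [Finset.mul_sum, Finset.sum_filter]
    refine Finset.sum_congr rfl fun g _ => ?_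
    simp only [snoc_isOrdering_iff, hη, true_and]
    split_ifs with h
    · have hlast : (Finset.Iic (Fin.last d)).image (Fin.snoc g η : Fin (d + 1) → ι) = σ := by
        rw [← Fin.top_eq_last, Finset.Iic_top]
        exact (snoc_isOrdering_iff.2 ⟨hη, h⟩).2
      have hface : ∀ j : Fin d, (Finset.Iic j.castSucc).image (Fin.snoc g η : Fin (d + 1) → ι) =
          (Finset.Iic j).image g := by
        intro j
        rw [← Fin.map_castSuccEmb_Iic, Finset.map_eq_image, Finset.image_image]
        exact Finset.image_congr fun i _ => by simp
      rw [Fin.prod_univ_castSucc, hlast, mul_comm]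
      simp only [Fin.snoc_last, Fin.snoc_castSucc, hface]
    · rfl
  · intro η _ hη
    refine Finset.sum_eq_zero fun g _ => if_neg fun h => hη ?_
    exact (snoc_isOrdering_iff.1 h).1

theorem gramSum_succ (F : SimplicialFan V ι) (d : ℕ) {σ : Finset ι} (hσ : σ ∈ F.cones)
    (z : ι → ℝ) :
    F.gramSum (d + 1) σ z = ∑ η ∈ σ,
      (z η - ⟪F.vertex (σ.erase η) z, F.u η⟫_ℝ) * F.gramSum d (σ.erase η) z := by
  rw [gramSum_eq_det_mul_orderingSum, orderingSum_succ, Finset.mul_sum]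
  refine Finset.sum_congr rfl fun η hη => ?_
  have h := F.sub_inner_vertex (Finset.notMem_erase η σ) (by rwa [Finset.insert_erase hη]) z
  rw [Finset.insert_erase hη] at h
  rw [gramSum_eq_det_mul_orderingSum, ← mul_assoc, ← mul_assoc, h, mul_comm (F.gram σ).det]

/-- The value at the zero cone of the `n`-fold divisor of a piecewise linear function. -/
theorem divisorHom_pow_apply_empty (F : SimplicialFan V ι) (z : ι → ℝ) (n : ℕ)
    (c : F.balancedWeights) :
    ((F.divisorHom z ^ n) c : Finset ι → ℝ) ∅ =
      ∑ σ ∈ F.conesOfDim n, (c : Finset ι → ℝ) σ * F.gramSum n σ z := by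
  induction n generalizing c with
  | zero =>
    have h0 : F.conesOfDim 0 = {∅} := by
      ext σ
      rw [conesOfDim, Finset.mem_filter, Finset.card_eq_zero, Finset.mem_singleton]
      exact ⟨fun h => h.2, fun h => ⟨h ▸ F.empty_mem, h⟩⟩
    rw [h0, Finset.sum_singleton, gramSum_zero_empty]
    simp
  | succ n ih =>
    rw [pow_succ, Module.End.mul_apply, ih]
    have hL : ∀ τ ∈ F.conesOfDim n, (F.divisorHom z c : Finset ι → ℝ) τ * F.gramSum n τ z =
        ∑ η ∈ τᶜ with insert η τ ∈ F.cones, (c : Finset ι → ℝ) (insert η τ) *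
          (z η - ⟪F.vertex τ z, F.u η⟫_ℝ) * F.gramSum n τ z := by
      intro τ _
      rw [coe_divisorHom_apply, divisor, Finset.sum_mul, Finset.sum_filter]
      refine Finset.sum_congr rfl fun η _ => ?_
      split_ifs with h
      · rfl
      · rw [c.2.1 _ h, zero_mul, zero_mul]
    have hR : ∀ σ ∈ F.conesOfDim (n + 1), (c : Finset ι → ℝ) σ * F.gramSum (n + 1) σ z =
        ∑ η ∈ σ, (c : Finset ι → ℝ) σ *
          (z η - ⟪F.vertex (σ.erase η) z, F.u η⟫_ℝ) * F.gramSum n (σ.erase η) z := by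
      intro σ hσ
      rw [F.gramSum_succ n (Finset.mem_filter.1 hσ).1, Finset.mul_sum]
      exact Finset.sum_congr rfl fun η _ => (mul_assoc _ _ _).symm
    rw [Finset.sum_congr rfl hL, Finset.sum_congr rfl hR, Finset.sum_sigma', Finset.sum_sigma']
    refine Finset.sum_bij' (fun x _ => ⟨insert x.2 x.1, x.2⟩) (fun x _ => ⟨x.1.erase x.2, x.2⟩)
      ?_ ?_ ?_ ?_ ?_
    · rintro ⟨τ, η⟩ h
      simp only [Finset.mem_sigma, Finset.mem_filter, Finset.mem_compl, conesOfDim] at h ⊢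
      exact ⟨⟨h.2.2, by rw [Finset.card_insert_of_notMem h.2.1, h.1.2]⟩,
        Finset.mem_insert_self η τ⟩
    · rintro ⟨σ, η⟩ h
      simp only [Finset.mem_sigma, Finset.mem_filter, Finset.mem_compl, conesOfDim] at h ⊢
      refine ⟨⟨F.face_mem σ h.1.1 _ (Finset.erase_subset η σ), ?_⟩, Finset.notMem_erase η σ, ?_⟩
      · rw [Finset.card_erase_of_mem h.2, h.1.2, Nat.add_sub_cancel]
      · rw [Finset.insert_erase h.2]
        exact h.1.1
    · rintro ⟨τ, η⟩ h
      simp only [Finset.mem_sigma, Finset.mem_filter, Finset.mem_compl] at h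
      simp only [Finset.erase_insert h.2.1]
    · rintro ⟨σ, η⟩ h
      simp only [Finset.mem_sigma] at h
      simp only [Finset.insert_erase h.2]
    · rintro ⟨τ, η⟩ h
      simp only [Finset.mem_sigma, Finset.mem_filter, Finset.mem_compl] at h
      simp only [Finset.erase_insert h.2.1]

theorem volumePolynomial_eq_sum_gramSum [FiniteDimensional ℝ V] (F : SimplicialFan V ι) {d : ℕ}
    {ω : Finset ι → ℝ} (hF : F.IsTropical d ω) {deg : F.chowGr d →ₗ[ℝ] ℝ}
    (hdeg : F.IsDegreeMap d ω deg) (D : F.chowGr 1) (z : ι → ℝ)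
    (hD : (D : F.ChowRing) = ∑ i, z i • F.divX i) :
    F.volumePolynomial d deg D = ∑ σ ∈ F.conesOfDim d, ω σ * F.gramSum d σ z := by
  obtain ⟨deg', hdeg', happly⟩ := F.exists_degreeMap hF
  obtain rfl := hdeg.unique hdeg'
  have hmk : Ideal.Quotient.mk (F.idealI ⊔ F.idealJ)
      ((∑ i, MvPolynomial.C (z i) * MvPolynomial.X i) ^ d) = (D : F.ChowRing) ^ d := by
    rw [map_pow, map_sum, hD]
    congr 1
    refine Finset.sum_congr rfl fun i _ => ?_
    rw [← MvPolynomial.smul_eq_C_mul]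
    rfl
  have h := happly _ ⟨_, F.pow_mem_chowGr D.2 d⟩ hmk
  rw [map_pow, polynomialAction_linearForm, divisorHom_pow_apply_empty] at h
  refine h.trans (Finset.sum_congr rfl fun σ hσ => ?_)
  exact congrArg (· * F.gramSum d σ z) (if_pos hσ)

end Orderings

/-! ### The polytopes of a pseudo-cubical value -/

section Polytope

variable {V ι : Type*} [NormedAddCommGroup V] [InnerProductSpace ℝ V] [DecidableEq ι]

theorem mem_cone_iff (F : SimplicialFan V ι) {σ : Finset ι} {x : V} :
    x ∈ F.cone σ ↔ ∃ a : σ → ℝ, (∀ i, 0 ≤ a i) ∧ ∑ i, a i • F.u i = x := by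
  refine (Submodule.mem_span_image_finset_iff_exists_fun _).trans ⟨?_, ?_⟩
  · rintro ⟨c, hc⟩
    exact ⟨fun i => c i, fun i => (c i).2, hc⟩
  · rintro ⟨a, ha, hx⟩
    exact ⟨fun i => ⟨a i, ha i⟩, hx⟩

theorem coord_nonneg (F : SimplicialFan V ι) {z : ι → ℝ} (hz : F.IsPseudoCubical z)
    {σ : Finset ι} (hσ : σ ∈ F.cones) {i : ι} (hi : i ∈ σ) : 0 ≤ F.coord σ z i := by
  obtain ⟨v, hv, hvz⟩ := hz σ hσ
  obtain ⟨a, ha, rfl⟩ := F.mem_cone_iff.1 hv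
  set b : ι → ℝ := fun j => if h : j ∈ σ then a ⟨j, h⟩ else 0 with hb
  have hab : ∑ j, a j • F.u j = ∑ j ∈ σ, b j • F.u j := by
    refine Eq.trans ?_ (Finset.sum_coe_sort σ fun j => b j • F.u j)
    exact Finset.sum_congr rfl fun j _ => by simp [hb]
  have hspan : ∑ j, a j • F.u j ∈ F.spanR σ :=
    Submodule.sum_mem _ fun j _ => Submodule.smul_mem _ _ (F.u_mem_spanR j.2)
  have h := F.eq_of_mem_spanR_of_inner_eq hspan (F.vertex_mem_spanR σ z) fun j hj => by
    rw [F.inner_vertex hσ z hj]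
    exact hvz j hj
  rw [hab] at h
  rw [← F.eq_of_sum_smul_eq hσ h hi]
  simp [hb, hi, ha]

theorem inner_vertex_le (F : SimplicialFan V ι) {z : ι → ℝ} (hz : F.IsPseudoCubical z)
    {τ : Finset ι} {η : ι} (hη : η ∉ τ) (hσ : insert η τ ∈ F.cones) :
    ⟪F.vertex τ z, F.u η⟫_ℝ ≤ z η := by
  have hτ : τ ∈ F.cones := F.face_mem _ hσ τ (Finset.subset_insert η τ)
  have h := F.sub_inner_vertex hη hσ z
  have h2 := mul_nonneg (F.coord_nonneg hz hσ (Finset.mem_insert_self η τ)) (F.det_gram_pos hσ).le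
  rw [← h] at h2
  exact sub_nonneg.1 (nonneg_of_mul_nonneg_left h2 (F.det_gram_pos hτ))

theorem eq_zero_of_inner_nonpos (F : SimplicialFan V ι) {σ : Finset ι} (hσ : σ ∈ F.cones)
    {b : ι → ℝ} (hb : ∀ i ∈ σ, 0 ≤ b i) (hle : ∀ i ∈ σ, ⟪∑ j ∈ σ, b j • F.u j, F.u i⟫_ℝ ≤ 0)
    {i : ι} (hi : i ∈ σ) : b i = 0 := by
  have h0 : ∑ j ∈ σ, b j • F.u j = 0 := by
    refine real_inner_self_nonpos.1 ?_
    rw [inner_sum]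
    refine Finset.sum_nonpos fun j hj => ?_
    rw [inner_smul_right]
    exact mul_nonpos_of_nonneg_of_nonpos (hb j hj) (hle j hj)
  exact F.eq_of_sum_smul_eq hσ (b := 0) (by simpa using h0) hi

/-- The vertex is the only point of the polytope that dominates it coordinatewise. -/
theorem eq_coord_of_coord_le (F : SimplicialFan V ι) (z : ι → ℝ) {σ : Finset ι}
    (hσ : σ ∈ F.cones) {a : ι → ℝ} (hle : ∀ i ∈ σ, ⟪∑ j ∈ σ, a j • F.u j, F.u i⟫_ℝ ≤ z i)
    (h : ∀ i ∈ σ, F.coord σ z i ≤ a i) {i : ι} (hi : i ∈ σ) : a i = F.coord σ z i := by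
  refine sub_eq_zero.1 (F.eq_zero_of_inner_nonpos hσ (b := fun i => a i - F.coord σ z i)
    (fun i hi => sub_nonneg.2 (h i hi)) (fun i hi => ?_) hi)
  simp only [sub_smul, Finset.sum_sub_distrib, inner_sub_left]
  have := F.inner_vertex hσ z hi
  rw [vertex] at this
  rw [this]
  exact sub_nonpos.2 (hle i hi)

/-- If some coefficient of the vertex is positive, then there is a ray `η` at which the ratio of the
coefficients of a given point and of the vertex is minimal. -/
theorem exists_min_ratio (F : SimplicialFan V ι) {z : ι → ℝ} (hz : F.IsPseudoCubical z)
    {σ : Finset ι} (hσ : σ ∈ F.cones) {a : ι → ℝ} (ha : ∀ i ∈ σ, 0 ≤ a i)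
    (hpos : ∃ i ∈ σ, 0 < F.coord σ z i) :
    ∃ η ∈ σ, 0 < F.coord σ z η ∧ ∀ i ∈ σ, a η * F.coord σ z i ≤ a i * F.coord σ z η := by
  obtain ⟨i, hi, hci⟩ := hpos
  obtain ⟨η, hη, hmin⟩ := Finset.exists_min_image (σ.filter fun i => 0 < F.coord σ z i)
    (fun i => a i / F.coord σ z i) ⟨i, Finset.mem_filter.2 ⟨hi, hci⟩⟩
  obtain ⟨hησ, hcη⟩ := Finset.mem_filter.1 hη
  refine ⟨η, hησ, hcη, fun j hj => ?_⟩
  rcases (F.coord_nonneg hz hσ hj).eq_or_lt with h0 | h0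
  · rw [← h0, mul_zero]
    exact mul_nonneg (ha j hj) hcη.le
  · exact (div_le_div_iff₀ hcη h0).1 (hmin j (Finset.mem_filter.2 ⟨hj, h0⟩))

theorem coord_eq_zero_or_exists_pos (F : SimplicialFan V ι) {z : ι → ℝ}
    (hz : F.IsPseudoCubical z) {σ : Finset ι} (hσ : σ ∈ F.cones) :
    (∀ i ∈ σ, F.coord σ z i = 0) ∨ ∃ i ∈ σ, 0 < F.coord σ z i := by
  by_cases h : ∃ i ∈ σ, 0 < F.coord σ z i
  · exact Or.inr h
  · push Not at h
    exact Or.inl fun i hi => le_antisymm (h i hi) (F.coord_nonneg hz hσ hi)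

/-- The decomposition `λ w + (1 - λ) p` of a point of the polytope of `insert η τ`, where `w` is the
vertex and `p` lies on the facet opposite to the ray `η`. -/
theorem sum_smul_eq_vertex_add (F : SimplicialFan V ι) (z : ι → ℝ) {τ : Finset ι} {η : ι}
    (hη : η ∉ τ) (a : ι → ℝ) {l : ℝ} (hl : l ≠ 1) (haη : a η = l * F.coord (insert η τ) z η) :
    ∑ i ∈ insert η τ, a i • F.u i = l • F.vertex (insert η τ) z +
      (1 - l) • ∑ i ∈ τ, ((1 - l)⁻¹ * (a i - l * F.coord (insert η τ) z i)) • F.u i := by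
  have h1 : 1 - l ≠ 0 := sub_ne_zero.2 hl.symm
  rw [vertex, Finset.sum_insert hη, Finset.sum_insert hη, Finset.smul_sum, smul_add,
    Finset.smul_sum, add_assoc, ← Finset.sum_add_distrib, haη, smul_smul]
  congr 1
  refine Finset.sum_congr rfl fun i _ => ?_
  rw [smul_smul, smul_smul, ← add_smul, mul_inv_cancel_left₀ h1, add_sub_cancel]

/-- The polytope of a cone `τ` satisfies the inequalities of all rays that span a cone together with
`τ`: it is a face of the polytope of the larger cone. -/
theorem inner_le_of_mem_polytope (F : SimplicialFan V ι) {z : ι → ℝ} (hz : F.IsPseudoCubical z)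
    {τ : Finset ι} {a : ι → ℝ} (ha : ∀ i ∈ τ, 0 ≤ a i)
    (hle : ∀ i ∈ τ, ⟪∑ j ∈ τ, a j • F.u j, F.u i⟫_ℝ ≤ z i)
    {θ : ι} (hθ : θ ∉ τ) (hσ : insert θ τ ∈ F.cones) :
    ⟪∑ j ∈ τ, a j • F.u j, F.u θ⟫_ℝ ≤ z θ := by
  induction hn : τ.card generalizing τ a with
  | zero =>
    rw [Finset.card_eq_zero] at hn
    subst hn
    simpa [vertex] using F.inner_vertex_le hz hθ hσ
  | succ n ih =>
    have hτ : τ ∈ F.cones := F.face_mem _ hσ τ (Finset.subset_insert θ τ)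
    -- A point dominating the vertex coordinatewise is the vertex.
    have hdom : (∀ i ∈ τ, F.coord τ z i ≤ a i) → ⟪∑ j ∈ τ, a j • F.u j, F.u θ⟫_ℝ ≤ z θ := by
      intro h
      rw [Finset.sum_congr rfl fun i hi => by rw [F.eq_coord_of_coord_le z hτ hle h hi]]
      exact F.inner_vertex_le hz hθ hσ
    rcases F.coord_eq_zero_or_exists_pos hz hτ with h0 | hpos
    · exact hdom fun i hi => by rw [h0 i hi]; exact ha i hi
    obtain ⟨η, hη, hcη, hmin⟩ := F.exists_min_ratio hz hτ ha hpos
    by_cases hη1 : F.coord τ z η ≤ a η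
    · refine hdom fun i hi => ?_
      refine le_of_mul_le_mul_right ?_ hcη
      rw [mul_comm (F.coord τ z i)]
      exact (mul_le_mul_of_nonneg_right hη1 (F.coord_nonneg hz hτ hi)).trans (hmin i hi)
    -- Otherwise the point lies on the segment from the vertex to a point of a proper face.
    push Not at hη1
    obtain ⟨κ, hηκ, rfl⟩ : ∃ κ, η ∉ κ ∧ insert η κ = τ :=
      ⟨τ.erase η, Finset.notMem_erase η τ, Finset.insert_erase hη⟩
    set l := a η / F.coord (insert η κ) z η with hl
    have hl0 : 0 ≤ l := div_nonneg (ha η hη) hcη.le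
    have hl1 : l < 1 := (div_lt_one hcη).2 hη1
    have h1 : 0 < 1 - l := sub_pos.2 hl1
    have hdec := F.sum_smul_eq_vertex_add z hηκ a hl1.ne (div_mul_cancel₀ _ hcη.ne').symm
    have hκθ : insert θ κ ∈ F.cones :=
      F.face_mem _ hσ _ (Finset.insert_subset_insert θ (Finset.subset_insert η κ))
    have hp := ih (τ := κ)
      (a := fun i => (1 - l)⁻¹ * (a i - l * F.coord (insert η κ) z i)) (fun i hi => ?_)
      (fun i hi => ?_) (fun h => hθ (Finset.mem_insert_of_mem h)) hκθ ?_
    · rw [hdec, inner_add_left, real_inner_smul_left, real_inner_smul_left]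
      have hw := F.inner_vertex_le hz hθ hσ
      nlinarith [mul_le_mul_of_nonneg_left hw hl0, mul_le_mul_of_nonneg_left hp h1.le]
    · refine mul_nonneg (inv_nonneg.2 h1.le) (sub_nonneg.2 ?_)
      rw [hl, div_mul_eq_mul_div, div_le_iff₀ hcη]
      exact hmin i (Finset.mem_insert_of_mem hi)
    · have hi' : i ∈ insert η κ := Finset.mem_insert_of_mem hi
      have h := hle i hi'
      rw [hdec, inner_add_left, real_inner_smul_left, real_inner_smul_left,
        F.inner_vertex hτ z hi'] at h
      refine le_of_mul_le_mul_left ?_ h1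
      linarith
    · rw [Finset.card_insert_of_notMem hηκ] at hn
      omega

end Polytope

/-! ### Volumes of the polytopes in coordinates -/

section Volume

open MeasureTheory
open scoped Pointwise

/-- A function on `σ`, extended by zero. -/
def extendZero {ι : Type*} [DecidableEq ι] (σ : Finset ι) (a : σ → ℝ) (i : ι) : ℝ :=
  if h : i ∈ σ then a ⟨i, h⟩ else 0

/-- The point of `ℝ^(τ ∪ η)` with coordinate `s` at `η` and the coordinates `y` on `τ`. -/
def insertCoord {ι : Type*} [DecidableEq ι] (τ : Finset ι) (η : ι) (x : (τ → ℝ) × ℝ)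
    (i : (insert η τ : Finset ι)) : ℝ :=
  if (i : ι) = η then x.2 else extendZero τ x.1 i

section Coordinates

variable {ι : Type*} [DecidableEq ι]

@[simp]
theorem extendZero_coe {σ : Finset ι} (a : σ → ℝ) (i : σ) : extendZero σ a i = a i :=
  dif_pos i.2

theorem extendZero_insertCoord_self (τ : Finset ι) (η : ι) (x : (τ → ℝ) × ℝ) :
    extendZero (insert η τ) (insertCoord τ η x) η = x.2 := by
  simp [extendZero, insertCoord]

theorem extendZero_insertCoord_of_mem {τ : Finset ι} {η : ι} (hη : η ∉ τ) (x : (τ → ℝ) × ℝ)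
    {i : ι} (hi : i ∈ τ) : extendZero (insert η τ) (insertCoord τ η x) i = extendZero τ x.1 i := by
  simp [extendZero, insertCoord, hi, ne_of_mem_of_not_mem hi hη]

theorem measurePreserving_insertCoord {τ : Finset ι} {η : ι} (hη : η ∉ τ) :
    MeasurePreserving (insertCoord τ η) (volume.prod volume) volume := by
  have h1 : MeasurePreserving (MeasurableEquiv.piOptionEquivProd fun _ : Option τ => ℝ).symm
      ((volume : Measure (τ → ℝ)).prod (volume : Measure ℝ)) volume :=
    ⟨MeasurableEquiv.measurable _,
      Measure.pi_map_piOptionEquivProd fun _ : Option τ => (volume : Measure ℝ)⟩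
  have h2 := volume_measurePreserving_piCongrLeft
    (fun _ : (insert η τ : Finset ι) => ℝ) (Finset.subtypeInsertEquivOption hη).symm
  have h := h2.comp h1
  convert h using 1
  ext x i
  rw [Function.comp_apply, MeasurableEquiv.coe_piCongrLeft, Equiv.piCongrLeft_apply]
  simp only [Equiv.symm_symm, eq_rec_constant]
  by_cases hi : (i : ι) = η
  · have hE : Finset.subtypeInsertEquivOption hη i = none := by
      simp [Finset.subtypeInsertEquivOption, hi]
    rw [hE, insertCoord, if_pos hi]
    rfl
  · have hiτ : (i : ι) ∈ τ := (Finset.mem_insert.1 i.2).resolve_left hi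
    have hE : Finset.subtypeInsertEquivOption hη i = some ⟨i, hiτ⟩ := by
      simp [Finset.subtypeInsertEquivOption, hi]
    rw [hE, insertCoord, if_neg hi, extendZero, dif_pos hiτ]
    rfl

end Coordinates

theorem lintegral_one_sub_div_pow {c : ℝ} (hc : 0 < c) (n : ℕ) :
    ∫⁻ s in Set.Ioo 0 c, ENNReal.ofReal ((1 - s / c) ^ n) = ENNReal.ofReal (c / (n + 1)) := by
  have hcont : Continuous fun s : ℝ => (1 - s / c) ^ n := by fun_prop
  rw [← ofReal_integral_eq_lintegral_ofReal]
  · rw [← integral_Ioc_eq_integral_Ioo, ← intervalIntegral.integral_of_le hc.le,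
      intervalIntegral.integral_comp_sub_div (fun x => x ^ n) hc.ne']
    simp [integral_pow, div_self hc.ne', div_eq_mul_inv]
  · exact (hcont.integrableOn_Icc (a := 0) (b := c)).mono_set Set.Ioo_subset_Icc_self
  · filter_upwards [ae_restrict_mem measurableSet_Ioo] with s hs
    exact pow_nonneg (sub_nonneg.2 ((div_le_one hc).2 hs.2.le)) n

variable {V ι : Type*} [NormedAddCommGroup V] [InnerProductSpace ℝ V] [DecidableEq ι]

/-- The polytope `P_{σ,*}(z)` in the coordinates with respect to the ray generators of `σ`. -/
def coordPolytope (F : SimplicialFan V ι) (σ : Finset ι) (z : ι → ℝ) : Set (σ → ℝ) :=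
  {a | (∀ i, 0 ≤ a i) ∧ ∀ i : σ, ⟪∑ j, a j • F.u j, F.u i⟫_ℝ ≤ z i}

/-- The pyramid in `P_{σ,*}(z)` with apex the vertex of `σ` over the facet opposite to `η`, in
coordinates. -/
def coordPyramid (F : SimplicialFan V ι) (σ : Finset ι) (z : ι → ℝ) (η : ι) : Set (σ → ℝ) :=
  {a | a ∈ F.coordPolytope σ z ∧
    ∀ i : σ, extendZero σ a η * F.coord σ z i ≤ a i * F.coord σ z η}

theorem sum_extendZero_smul (F : SimplicialFan V ι) {σ : Finset ι} (a : σ → ℝ) :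
    ∑ j ∈ σ, extendZero σ a j • F.u j = ∑ j, a j • F.u j := by
  refine (Finset.sum_coe_sort σ fun j => extendZero σ a j • F.u j).symm.trans ?_
  exact Finset.sum_congr rfl fun j _ => by rw [extendZero_coe]

theorem mem_coordPolytope_iff (F : SimplicialFan V ι) {σ : Finset ι} {z : ι → ℝ} {a : σ → ℝ} :
    a ∈ F.coordPolytope σ z ↔ (∀ i ∈ σ, 0 ≤ extendZero σ a i) ∧
      ∀ i ∈ σ, ⟪∑ j ∈ σ, extendZero σ a j • F.u j, F.u i⟫_ℝ ≤ z i := by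
  rw [sum_extendZero_smul]
  refine and_congr ⟨fun h i hi => ?_, fun h i => ?_⟩
    ⟨fun h i hi => h ⟨i, hi⟩, fun h i => h i i.2⟩
  · exact (extendZero_coe a ⟨i, hi⟩).symm ▸ h ⟨i, hi⟩
  · exact extendZero_coe a i ▸ h i i.2

theorem measurableSet_coordPolytope (F : SimplicialFan V ι) (σ : Finset ι) (z : ι → ℝ) :
    MeasurableSet (F.coordPolytope σ z) := by
  refine IsClosed.measurableSet ?_
  simp only [coordPolytope, Set.ofPred_and, Set.ofPred_forall]
  refine IsClosed.inter (isClosed_iInter fun i => isClosed_le ?_ ?_)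
    (isClosed_iInter fun i => isClosed_le ?_ ?_)
  all_goals fun_prop

theorem measurableSet_coordPyramid (F : SimplicialFan V ι) (σ : Finset ι) (z : ι → ℝ) {η : ι}
    (hη : η ∈ σ) : MeasurableSet (F.coordPyramid σ z η) := by
  have h : IsClosed {a : σ → ℝ | ∀ i : σ,
      extendZero σ a η * F.coord σ z i ≤ a i * F.coord σ z η} := by
    simp only [Set.ofPred_forall, extendZero, dif_pos hη]
    refine isClosed_iInter fun i => isClosed_le ?_ ?_
    all_goals fun_prop
  exact (F.measurableSet_coordPolytope σ z).inter h.measurableSet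

/-- The slices of the pyramid over the facet opposite to `η` parallel to this facet are translates
of rescaled copies of the facet. -/
theorem insertCoord_mem_coordPyramid_iff (F : SimplicialFan V ι) {z : ι → ℝ}
    (hz : F.IsPseudoCubical z) {τ : Finset ι} {η : ι} (hη : η ∉ τ) (hσ : insert η τ ∈ F.cones)
    (hc : 0 < F.coord (insert η τ) z η) {s : ℝ} (hs : s ∈ Set.Ioo 0 (F.coord (insert η τ) z η))
    (y : τ → ℝ) :
    insertCoord τ η (y, s) ∈ F.coordPyramid (insert η τ) z η ↔
      (1 - s / F.coord (insert η τ) z η)⁻¹ •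
        (y + -fun i : τ => s / F.coord (insert η τ) z η * F.coord (insert η τ) z i) ∈
      F.coordPolytope τ z := by
  set c := F.coord (insert η τ) z with hcdef
  set l := s / c η with hl
  have hlc : l * c η = s := div_mul_cancel₀ _ hc.ne'
  have hl1 : 0 < 1 - l := sub_pos.2 ((div_lt_one hc).2 hs.2)
  set a := extendZero (insert η τ) (insertCoord τ η (y, s)) with ha
  have haη : a η = s := extendZero_insertCoord_self τ η (y, s)
  have haτ : ∀ i ∈ τ, a i = extendZero τ y i := fun i hi =>
    extendZero_insertCoord_of_mem hη (y, s) hi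
  set p := (1 - l)⁻¹ • (y + -fun i : τ => l * c i) with hp
  have hpa : ∀ i ∈ τ, extendZero τ p i = (1 - l)⁻¹ * (a i - l * c i) := by
    intro i hi
    rw [haτ i hi]
    simp [extendZero, hi, hp, sub_eq_add_neg, mul_add]
  have hdec : ∑ i ∈ insert η τ, a i • F.u i = l • F.vertex (insert η τ) z +
      (1 - l) • ∑ i ∈ τ, extendZero τ p i • F.u i := by
    rw [F.sum_smul_eq_vertex_add z hη a (sub_pos.1 hl1).ne (haη.trans hlc.symm)]
    congr 2
    exact Finset.sum_congr rfl fun i hi => by rw [hpa i hi]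
  have hinner : ∀ i ∈ insert η τ, (⟪∑ j ∈ insert η τ, a j • F.u j, F.u i⟫_ℝ ≤ z i ↔
      ⟪∑ j ∈ τ, extendZero τ p j • F.u j, F.u i⟫_ℝ ≤ z i) := by
    intro i hi
    rw [hdec, inner_add_left, real_inner_smul_left, real_inner_smul_left, F.inner_vertex hσ z hi]
    refine ⟨fun h => le_of_mul_le_mul_left ?_ hl1, fun h => ?_⟩
    · linarith
    · have := mul_le_mul_of_nonneg_left h hl1.le
      linarith
  have hpos : ∀ i ∈ τ, (a η * c i ≤ a i * c η ↔ 0 ≤ extendZero τ p i) := by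
    intro i hi
    rw [hpa i hi, mul_nonneg_iff_of_pos_left (inv_pos.2 hl1), sub_nonneg, haη, hl,
      div_mul_eq_mul_div, div_le_iff₀ hc]
  have hpyr : insertCoord τ η (y, s) ∈ F.coordPyramid (insert η τ) z η ↔
      insertCoord τ η (y, s) ∈ F.coordPolytope (insert η τ) z ∧
        ∀ i ∈ insert η τ, a η * c i ≤ a i * c η := by
    refine and_congr Iff.rfl ⟨fun h i hi => ?_, fun h i => ?_⟩
    · have := h ⟨i, hi⟩
      rwa [← extendZero_coe (insertCoord τ η (y, s))] at this
    · rw [← extendZero_coe (insertCoord τ η (y, s))]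
      exact h i i.2
  rw [hpyr, mem_coordPolytope_iff, mem_coordPolytope_iff]
  constructor
  · rintro ⟨⟨_, h2⟩, h3⟩
    exact ⟨fun i hi => (hpos i hi).1 (h3 i (Finset.mem_insert_of_mem hi)),
      fun i hi => (hinner i (Finset.mem_insert_of_mem hi)).1 (h2 i (Finset.mem_insert_of_mem hi))⟩
  · rintro ⟨h1, h2⟩
    have h3 : ∀ i ∈ insert η τ, a η * c i ≤ a i * c η := by
      intro i hi
      rcases Finset.mem_insert.1 hi with rfl | hi
      · exact le_rfl
      · exact (hpos i hi).2 (h1 i hi)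
    refine ⟨⟨fun i hi => ?_, fun i hi => (hinner i hi).2 ?_⟩, h3⟩
    · refine nonneg_of_mul_nonneg_left
        ((mul_nonneg ?_ (F.coord_nonneg hz hσ hi)).trans (h3 i hi)) hc
      exact haη ▸ hs.1.le
    · rcases Finset.mem_insert.1 hi with rfl | hi
      · exact F.inner_le_of_mem_polytope hz h1 h2 hη hσ
      · exact h2 i hi

/-- The volume of a pyramid is its height times the volume of its base, divided by the dimension. -/
theorem volume_coordPyramid (F : SimplicialFan V ι) {z : ι → ℝ}
    (hz : F.IsPseudoCubical z) {τ : Finset ι} {η : ι} (hη : η ∉ τ) (hσ : insert η τ ∈ F.cones)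
    (hc : 0 < F.coord (insert η τ) z η) :
    volume (F.coordPyramid (insert η τ) z η) =
      ENNReal.ofReal (F.coord (insert η τ) z η / (τ.card + 1)) *
        volume (F.coordPolytope τ z) := by
  have hmeas := F.measurableSet_coordPyramid (insert η τ) z (Finset.mem_insert_self η τ)
  have hmp := measurePreserving_insertCoord hη
  rw [← hmp.measure_preimage hmeas.nullMeasurableSet,
    Measure.prod_apply_symm (hmp.measurable hmeas)]
  set c := F.coord (insert η τ) z with hcdef
  have hin : ∀ s ∈ Set.Ioo 0 (c η),
      volume ((fun y => (y, s)) ⁻¹' (insertCoord τ η ⁻¹' F.coordPyramid (insert η τ) z η)) =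
        ENNReal.ofReal ((1 - s / c η) ^ τ.card) * volume (F.coordPolytope τ z) := by
    intro s hs
    have hl1 : 0 < 1 - s / c η := sub_pos.2 ((div_lt_one hc).2 hs.2)
    have hset : (fun y => (y, s)) ⁻¹' (insertCoord τ η ⁻¹' F.coordPyramid (insert η τ) z η) =
        (fun y => y + -fun i : τ => s / c η * c i) ⁻¹'
          ((1 - s / c η) • F.coordPolytope τ z) := by
      ext y
      rw [Set.mem_preimage, Set.mem_preimage, Set.mem_preimage,
        F.insertCoord_mem_coordPyramid_iff hz hη hσ hc hs,
        Set.mem_smul_set_iff_inv_smul_mem₀ hl1.ne']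
    rw [hset, measure_preimage_add_right, Measure.addHaar_smul, Module.finrank_fintype_fun_eq_card,
      Fintype.card_coe, abs_of_nonneg (pow_nonneg hl1.le _)]
  -- Slices behind the base or beyond the apex are empty; a point of a slice beyond the apex would
  -- dominate the vertex.
  have hout : ∀ s, s ∉ Set.Icc 0 (c η) →
      volume ((fun y => (y, s)) ⁻¹' (insertCoord τ η ⁻¹' F.coordPyramid (insert η τ) z η)) = 0 := by
    intro s hs
    refine (congrArg volume (Set.eq_empty_of_forall_notMem fun y hy => ?_)).trans measure_empty
    have hy1 : insertCoord τ η (y, s) ∈ F.coordPolytope (insert η τ) z := hy.1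
    have hy2 := hy.2
    rw [mem_coordPolytope_iff] at hy1
    have hself := extendZero_insertCoord_self τ η (y, s)
    have hs0 : 0 ≤ s := by
      have h := hy1.1 η (Finset.mem_insert_self η τ)
      rwa [hself] at h
    have hsc : c η < s := by
      by_contra h
      exact hs ⟨hs0, not_lt.1 h⟩
    have h := F.eq_coord_of_coord_le z hσ hy1.2 (fun i hi => ?_) (Finset.mem_insert_self η τ)
    · rw [hself] at h
      exact hsc.ne' h
    · have h := hy2 ⟨i, hi⟩
      rw [hself, ← extendZero_coe (insertCoord τ η (y, s))] at h
      refine le_of_mul_le_mul_right ?_ hc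
      refine le_trans ?_ h
      rw [mul_comm]
      exact mul_le_mul_of_nonneg_right hsc.le (F.coord_nonneg hz hσ hi)
  have hae : ∀ᵐ s : ℝ,
      volume ((fun y => (y, s)) ⁻¹' (insertCoord τ η ⁻¹' F.coordPyramid (insert η τ) z η)) =
      (Set.Ioo 0 (c η)).indicator
        (fun s => ENNReal.ofReal ((1 - s / c η) ^ τ.card) * volume (F.coordPolytope τ z)) s := by
    filter_upwards [Measure.ae_ne volume (0 : ℝ), Measure.ae_ne volume (c η)] with s hs0 hsc
    by_cases hs : s ∈ Set.Ioo 0 (c η)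
    · rw [Set.indicator_of_mem hs, hin s hs]
    · rw [Set.indicator_of_notMem hs, hout s]
      exact fun h => hs ⟨lt_of_le_of_ne h.1 hs0.symm, lt_of_le_of_ne h.2 hsc⟩
  rw [lintegral_congr_ae hae, lintegral_indicator measurableSet_Ioo, lintegral_mul_const,
    lintegral_one_sub_div_pow hc]
  fun_prop

theorem coordPolytope_eq_biUnion (F : SimplicialFan V ι) {z : ι → ℝ} (hz : F.IsPseudoCubical z)
    {σ : Finset ι} (hσ : σ ∈ F.cones) (hpos : ∃ i ∈ σ, 0 < F.coord σ z i) :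
    F.coordPolytope σ z = ⋃ η ∈ σ.filter (fun i => 0 < F.coord σ z i), F.coordPyramid σ z η := by
  refine Set.Subset.antisymm (fun a ha => ?_) (Set.iUnion₂_subset fun η _ a ha => ha.1)
  obtain ⟨η, hη, hcη, hmin⟩ :=
    F.exists_min_ratio hz hσ ((F.mem_coordPolytope_iff).1 ha).1 hpos
  refine Set.mem_biUnion (Finset.mem_filter.2 ⟨hη, hcη⟩) ⟨ha, fun i => ?_⟩
  simpa using hmin i i.2

theorem aedisjoint_coordPyramid (F : SimplicialFan V ι) {z : ι → ℝ} {σ : Finset ι} {η θ : ι}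
    (hη : η ∈ σ) (hθ : θ ∈ σ) (hne : η ≠ θ) (hc : 0 < F.coord σ z θ) :
    AEDisjoint volume (F.coordPyramid σ z η) (F.coordPyramid σ z θ) := by
  -- Two pyramids meet inside a hyperplane.
  let φ : (σ → ℝ) →ₗ[ℝ] ℝ := F.coord σ z θ • LinearMap.proj ⟨η, hη⟩ -
    F.coord σ z η • LinearMap.proj ⟨θ, hθ⟩
  have hφ : LinearMap.ker φ ≠ ⊤ := by
    intro h
    have h1 : (Pi.single ⟨η, hη⟩ 1 : σ → ℝ) ∈ LinearMap.ker φ := h ▸ Submodule.mem_top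
    have hne' : (⟨θ, hθ⟩ : σ) ≠ ⟨η, hη⟩ := fun h => hne (congrArg Subtype.val h).symm
    simp [φ, hne', hc.ne'] at h1
  refine measure_mono_null (fun a ha => ?_) (Measure.addHaar_submodule volume _ hφ)
  have h1 := ha.1.2 ⟨θ, hθ⟩
  have h2 := ha.2.2 ⟨η, hη⟩
  simp only [extendZero, hη, hθ, dif_pos] at h1 h2
  rw [SetLike.mem_coe, LinearMap.mem_ker]
  simp only [φ, LinearMap.sub_apply, LinearMap.smul_apply, LinearMap.proj_apply, smul_eq_mul]
  linarith

/-- The polytope of a cone is the union of the pyramids with apex its vertex over the polytopes of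
its facets. -/
theorem volume_coordPolytope_eq_sum (F : SimplicialFan V ι) {z : ι → ℝ}
    (hz : F.IsPseudoCubical z) {σ : Finset ι} (hσ : σ ∈ F.cones) (hne : σ.Nonempty) :
    volume (F.coordPolytope σ z) = ∑ η ∈ σ, ENNReal.ofReal (F.coord σ z η / σ.card) *
      volume (F.coordPolytope (σ.erase η) z) := by
  rcases F.coord_eq_zero_or_exists_pos hz hσ with h0 | hpos
  · rw [Finset.sum_eq_zero fun η hη => by rw [h0 η hη, zero_div, ENNReal.ofReal_zero, zero_mul]]
    have : Nonempty σ := hne.to_subtype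
    refine measure_mono_null (t := {0}) (fun a ha => ?_) (measure_singleton _)
    rw [mem_coordPolytope_iff] at ha
    ext i
    have h := F.eq_coord_of_coord_le z hσ ha.2 (fun i hi => by rw [h0 i hi]; exact ha.1 i hi) i.2
    rwa [h0 i i.2, extendZero_coe] at h
  · rw [F.coordPolytope_eq_biUnion hz hσ hpos, measure_biUnion_finset₀]
    · rw [Finset.sum_filter]
      refine Finset.sum_congr rfl fun η hη => ?_
      split_ifs with hc
      · obtain ⟨τ, hητ, rfl⟩ : ∃ τ, η ∉ τ ∧ insert η τ = σ :=
          ⟨σ.erase η, Finset.notMem_erase η σ, Finset.insert_erase hη⟩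
        rw [F.volume_coordPyramid hz hητ hσ hc, Finset.erase_insert hητ,
          Finset.card_insert_of_notMem hητ]
        push_cast
        rfl
      · rw [le_antisymm (not_lt.1 hc) (F.coord_nonneg hz hσ hη), zero_div, ENNReal.ofReal_zero,
          zero_mul]
    · intro η hη θ hθ hne
      obtain ⟨hη, _⟩ := Finset.mem_filter.1 hη
      obtain ⟨hθ, hcθ⟩ := Finset.mem_filter.1 hθ
      exact F.aedisjoint_coordPyramid hη hθ hne hcθ
    · intro η hη
      exact (F.measurableSet_coordPyramid σ z (Finset.mem_filter.1 hη).1).nullMeasurableSet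

theorem orderingSum_zero_empty (F : SimplicialFan V ι) (z : ι → ℝ) :
    F.orderingSum 0 ∅ z = 1 := by
  have h := F.gramSum_zero_empty z
  rwa [gramSum_eq_det_mul_orderingSum, Matrix.det_isEmpty, one_mul] at h

/-- The volume in coordinates satisfies the recursion of the sum over orderings. -/
theorem volume_coordPolytope [Fintype ι] (F : SimplicialFan V ι) {z : ι → ℝ}
    (hz : F.IsPseudoCubical z) (n : ℕ) {σ : Finset ι} (hσ : σ ∈ F.conesOfDim n) :
    0 ≤ F.orderingSum n σ z ∧ volume (F.coordPolytope σ z) =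
      ENNReal.ofReal (F.orderingSum n σ z / n.factorial) := by
  induction n generalizing σ with
  | zero =>
    obtain rfl := Finset.card_eq_zero.1 (Finset.mem_filter.1 hσ).2
    have huniv : F.coordPolytope ∅ z = Set.univ := by
      ext a
      simp [coordPolytope]
    rw [orderingSum_zero_empty, huniv]
    refine ⟨zero_le_one, ?_⟩
    rw [volume_pi, Measure.pi_of_empty]
    simp
  | succ n ih =>
    obtain ⟨hσc, hcard⟩ := Finset.mem_filter.1 hσ
    have herase : ∀ η ∈ σ, σ.erase η ∈ F.conesOfDim n := fun η hη =>
      Finset.mem_filter.2 ⟨F.face_mem σ hσc _ (Finset.erase_subset η σ),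
        by rw [Finset.card_erase_of_mem hη, hcard, Nat.add_sub_cancel]⟩
    have hnonneg : ∀ η ∈ σ, 0 ≤ F.coord σ z η * F.orderingSum n (σ.erase η) z := fun η hη =>
      mul_nonneg (F.coord_nonneg hz hσc hη) (ih (herase η hη)).1
    rw [orderingSum_succ]
    refine ⟨Finset.sum_nonneg hnonneg, ?_⟩
    rw [F.volume_coordPolytope_eq_sum hz hσc (Finset.card_pos.1 (by omega)), Finset.sum_div,
      ENNReal.ofReal_sum_of_nonneg fun η hη => div_nonneg (hnonneg η hη) (Nat.cast_nonneg _)]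
    refine Finset.sum_congr rfl fun η hη => ?_
    rw [(ih (herase η hη)).2, hcard, ← ENNReal.ofReal_mul
      (div_nonneg (F.coord_nonneg hz hσc hη) (Nat.cast_nonneg _)), div_mul_div_comm,
      Nat.factorial_succ, Nat.cast_mul]

end Volume

/-! ### Normalization of the volume and conclusion -/

section Normalization

open MeasureTheory

variable {V ι : Type*} [NormedAddCommGroup V] [InnerProductSpace ℝ V] [DecidableEq ι]

/-- The basis of the span of a cone given by its ray generators. -/
def rayBasis (F : SimplicialFan V ι) {σ : Finset ι} (hσ : σ ∈ F.cones) :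
    Module.Basis σ ℝ (F.spanR σ) :=
  Module.Basis.mk (v := fun i : σ => (⟨F.u i, F.u_mem_spanR i.2⟩ : F.spanR σ))
    (LinearIndependent.of_comp (F.spanR σ).subtype (F.linearIndepOn σ hσ)) (by
      rintro ⟨x, hx⟩ -
      obtain ⟨c, hc⟩ := (Submodule.mem_span_image_finset_iff_exists_fun ℝ).1 hx
      have h : (⟨x, hx⟩ : F.spanR σ) = ∑ i : σ, c i • ⟨F.u i, F.u_mem_spanR i.2⟩ := by
        ext
        simp [← hc]
      rw [h]
      exact Submodule.sum_mem _ fun i _ => Submodule.smul_mem _ _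
        (Submodule.subset_span ⟨i, rfl⟩))

@[simp]
theorem coe_rayBasis (F : SimplicialFan V ι) {σ : Finset ι} (hσ : σ ∈ F.cones) (i : σ) :
    (F.rayBasis hσ i : V) = F.u i := by
  rw [rayBasis, Module.Basis.mk_apply]

theorem nondegenerate_innerₗ {E : Type*} [NormedAddCommGroup E] [InnerProductSpace ℝ E] :
    LinearMap.BilinForm.Nondegenerate (innerₗ E) :=
  ⟨fun x h => inner_self_eq_zero.1 (h x), fun x h => inner_self_eq_zero.1 (h x)⟩

/-- The basis of the span of a cone dual to its ray generators. -/
def dualRayBasis (F : SimplicialFan V ι) {σ : Finset ι} (hσ : σ ∈ F.cones) :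
    Module.Basis σ ℝ (F.spanR σ) :=
  LinearMap.BilinForm.dualBasis (innerₗ (F.spanR σ)) nondegenerate_innerₗ (F.rayBasis hσ)

theorem dualRayBasis_repr_apply (F : SimplicialFan V ι) {σ : Finset ι} (hσ : σ ∈ F.cones)
    (x : F.spanR σ) (i : σ) : (F.dualRayBasis hσ).repr x i = ⟪(x : V), F.u i⟫_ℝ := by
  rw [dualRayBasis, LinearMap.BilinForm.dualBasis_repr_apply, innerₗ_apply_apply,
    Submodule.coe_inner, coe_rayBasis]

theorem latticeM_eq_span (F : SimplicialFan V ι) {σ : Finset ι} (hσ : σ ∈ F.cones) :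
    F.latticeM σ = Submodule.span ℤ (Set.range (F.dualRayBasis hσ)) := by
  ext x
  rw [Module.Basis.mem_span_iff_repr_mem]
  simp only [dualRayBasis_repr_apply]
  constructor
  · intro hx i
    obtain ⟨n, hn⟩ := hx _ (Submodule.subset_span ⟨i, i.2, rfl⟩)
    exact ⟨n, hn.symm⟩
  · intro hx w hw
    induction hw using Submodule.span_induction with
    | mem w hw =>
      obtain ⟨i, hi, rfl⟩ := hw
      obtain ⟨n, hn⟩ := hx ⟨i, hi⟩
      exact ⟨n, hn.symm⟩
    | zero => exact ⟨0, by simp⟩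
    | add a b _ _ ha hb =>
      obtain ⟨m, hm⟩ := ha
      obtain ⟨n, hn⟩ := hb
      exact ⟨m + n, by simp [inner_add_right, hm, hn]⟩
    | smul c a _ ha =>
      obtain ⟨m, hm⟩ := ha
      refine ⟨c * m, ?_⟩
      rw [← Int.cast_smul_eq_zsmul ℝ c a, inner_smul_right, hm]
      push_cast
      rfl

theorem det_dualRayBasis (F : SimplicialFan V ι) {σ : Finset ι} (hσ : σ ∈ F.cones) :
    (F.dualRayBasis hσ).det (F.rayBasis hσ) = (F.gram σ).det := by
  rw [Module.Basis.det_apply, ← Matrix.det_transpose]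
  congr 1
  ext i j
  rw [Matrix.transpose_apply, Module.Basis.toMatrix_apply, dualRayBasis_repr_apply, coe_rayBasis]
  rfl

theorem preimage_polytope (F : SimplicialFan V ι) {σ : Finset ι} (hσ : σ ∈ F.cones)
    (z : ι → ℝ) : (fun v : F.spanR σ => (v : V)) ⁻¹' F.polytope σ z =
      (F.rayBasis hσ).equivFun ⁻¹' F.coordPolytope σ z := by
  ext x
  have hsum : ∀ a : σ → ℝ, (((F.rayBasis hσ).equivFun.symm a : F.spanR σ) : V) =
      ∑ i, a i • F.u i := by
    intro a
    simp [Module.Basis.equivFun_symm_apply]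
  obtain ⟨a, rfl⟩ := (F.rayBasis hσ).equivFun.symm.surjective x
  rw [Set.mem_preimage, Set.mem_preimage, LinearEquiv.apply_symm_apply, polytope, hsum]
  refine and_congr ⟨fun h => ?_, fun h => F.mem_cone_iff.2 ⟨a, h, rfl⟩⟩
    ⟨fun h i => h i i.2, fun h i hi => h ⟨i, hi⟩⟩
  obtain ⟨b, hb, hab⟩ := F.mem_cone_iff.1 h
  rw [← hsum, ← hsum, Subtype.coe_inj, EmbeddingLike.apply_eq_iff_eq] at hab
  exact hab ▸ hb

variable [FiniteDimensional ℝ V] [MeasurableSpace V] [BorelSpace V]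

/-- In coordinates with respect to the ray generators of a `k`-dimensional cone `σ`, the volume
`Vol_σ` is `k! det(G_σ)` times Lebesgue measure: the Gram matrix is the base change to the dual
basis, which is a basis of the lattice `M_σ`. -/
theorem coneVolume_polytope (F : SimplicialFan V ι) {σ : Finset ι} (hσ : σ ∈ F.cones)
    (z : ι → ℝ) : F.coneVolume σ (F.polytope σ z) =
      σ.card.factorial * volume.real (F.coordPolytope σ z) * (F.gram σ).det := by
  set μ : Measure (F.spanR σ) := Measure.addHaar with hμ
  set b := F.rayBasis hσ with hb
  have hcov : ZLattice.covolume (F.latticeM σ) μ =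
      μ.real (ZSpan.fundamentalDomain (F.dualRayBasis hσ)) := by
    rw [F.latticeM_eq_span hσ]
    exact ZLattice.covolume_eq_measure_fundamentalDomain _ μ (ZSpan.isAddFundamentalDomain _ μ)
  have hd := F.det_gram_pos hσ
  have hfd : μ.real (ZSpan.fundamentalDomain b) =
      (F.gram σ).det * μ.real (ZSpan.fundamentalDomain (F.dualRayBasis hσ)) := by
    rw [ZSpan.measureReal_fundamentalDomain b μ (F.dualRayBasis hσ), det_dualRayBasis,
      abs_of_pos hd]
  let e : F.spanR σ ≃L[ℝ] (σ → ℝ) := b.equivFun.toContinuousLinearEquiv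
  -- Both measures on the coordinate space are Haar measures, hence proportional.
  obtain ⟨κ, hκ⟩ : ∃ κ : ℝ, ∀ s : Set (σ → ℝ),
      μ.real (b.equivFun ⁻¹' s) = κ * volume.real s := by
    have : (μ.map e).IsAddHaarMeasure := e.isAddHaarMeasure_map μ
    refine ⟨(μ.map e).addHaarScalarFactor volume, fun s => ?_⟩
    have hmap : μ (b.equivFun ⁻¹' s) = μ.map e s :=
      (e.toHomeomorph.toMeasurableEquiv.map_apply s).symm
    have h := congrArg (fun ν : Measure (σ → ℝ) => ν.real s)
      (Measure.isAddLeftInvariant_eq_smul (μ.map e) volume)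
    simp only [measureReal_nnreal_smul_apply] at h
    rw [← h, measureReal_def, hmap, ← measureReal_def]
  have hunit : μ.real (ZSpan.fundamentalDomain b) = κ := by
    have hset : ZSpan.fundamentalDomain b =
        b.equivFun ⁻¹' ZSpan.fundamentalDomain (Pi.basisFun ℝ σ) := by
      ext x
      simp [ZSpan.mem_fundamentalDomain]
    have hone : volume.real (ZSpan.fundamentalDomain (Pi.basisFun ℝ σ)) = 1 := by
      rw [ZSpan.fundamentalDomain_pi_basisFun, measureReal_def, volume_pi, Measure.pi_pi]
      simp
    rw [hset, hκ, hone, mul_one]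
  have hne : μ.real (ZSpan.fundamentalDomain (F.dualRayBasis hσ)) ≠ 0 :=
    ENNReal.toReal_ne_zero.2 ⟨ZSpan.measure_fundamentalDomain_ne_zero _,
      (ZSpan.fundamentalDomain_isBounded _).measure_lt_top.ne⟩
  rw [coneVolume, hcov, F.preimage_polytope hσ, hκ, ← hunit, hfd]
  field_simp

theorem sum_gramSum_eq_normalComplexVolume [Fintype ι] (F : SimplicialFan V ι) (d : ℕ)
    (ω : Finset ι → ℝ) {z : ι → ℝ} (hz : F.IsPseudoCubical z) :
    ∑ σ ∈ F.conesOfDim d, ω σ * F.gramSum d σ z = F.normalComplexVolume d ω z := by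
  refine Finset.sum_congr rfl fun σ hσ => ?_
  obtain ⟨hσc, hcard⟩ := Finset.mem_filter.1 hσ
  obtain ⟨h0, hvol⟩ := F.volume_coordPolytope hz d hσ
  rw [F.coneVolume_polytope hσc, measureReal_def, hvol, hcard,
    ENNReal.toReal_ofReal (div_nonneg h0 (Nat.cast_nonneg _)),
    mul_div_cancel₀ _ (Nat.cast_ne_zero.2 (Nat.factorial_ne_zero d)),
    gramSum_eq_det_mul_orderingSum, mul_comm (F.gram σ).det]

end Normalization

end SimplicialFan

end

theorem mainTheorem1 {V ι : Type*} [NormedAddCommGroup V] [InnerProductSpace ℝ V]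
    [FiniteDimensional ℝ V] [MeasurableSpace V] [BorelSpace V] [Fintype ι] [DecidableEq ι]
    (F : SimplicialFan V ι) (d : ℕ) (ω : Finset ι → ℝ) (hF : F.IsTropical d ω) :
    (∃! deg : F.chowGr d →ₗ[ℝ] ℝ, F.IsDegreeMap d ω deg) ∧
    ∀ deg : F.chowGr d →ₗ[ℝ] ℝ, F.IsDegreeMap d ω deg →
      ∀ (D : F.chowGr 1) (z : ι → ℝ), (D : F.ChowRing) = ∑ i, z i • F.divX i →
        F.volumePolynomial d deg D = ∑ σ ∈ F.conesOfDim d, ω σ * F.gramSum d σ z ∧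
        (F.IsPseudoCubical z →
          F.volumePolynomial d deg D = F.normalComplexVolume d ω z) := by
  obtain ⟨deg, hdeg, -⟩ := F.exists_degreeMap hF
  refine ⟨⟨deg, hdeg, fun deg' h => h.unique hdeg⟩, fun deg hdeg D z hD => ?_⟩
  have h := F.volumePolynomial_eq_sum_gramSum hF hdeg D z hD
  exact ⟨h, fun hz => h.trans (F.sum_gramSum_eq_normalComplexVolume d ω hz)⟩
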